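/- Theorem (Verblunsky coefficients of $S_m^{(t)}$). Let $\psi$ be a positive measure on $[-1,1]$ whose support is infinite and for which $\int_{-1}^{1}(1-x^2)^{-1/2}\,d\psi(x)<\infty$. Define $\widehat{\mathcal W}_m$, $\widehat\rho_m$, $\widehat\beta_m$, $\widehat\alpha_m$ recursively by $$\widehat{\mathcal W}_0=1,\qquad \widehat{\mathcal W}_1(x)=x-\widehat\beta_1\sqrt{1-x^2},\qquad \widehat{\mathcal W}_{m+1}(x)=\big[x-\widehat\beta_{m+1}\sqrt{1-x^2}\big]\widehat{\mathcal W}_m(x)-\widehat\alpha_{m+1}\widehat{\mathcal W}_{m-1}(x)\quad(m\ge1),$$ where $\widehat\rho_m=\int_{-1}^{1}\widehat{\mathcal W}_m^2(x)\sqrt{1-x^2}\,d\psi(x)$ and $\widehat\beta_{m+1}=\widehat\rho_m^{-1}\int_{-1}^{1}x\,\widehat{\mathcal W}_m^2(x)\,d\psi(x)$ for $m\ge0$, and $\widehat\alpha_{m+1}=\widehat\rho_{m-1}^{-1}\int_{-1}^{1}\big[x-\widehat\beta_{m+1}\sqrt{1-x^2}\big]\widehat{\mathcal W}_{m-1}(x)\widehat{\mathcal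 W}_m(x)\sqrt{1-x^2}\,d\psi(x)$ for $m\ge1$. Let $0\le t<1$ and let $\mu^{(t)}$ be the probability measure on the unit circle that has a point mass of size $t$ at $z=1$ (no point mass there if $t=0$) and satisfies $$-\sin(\theta/2)\,d\mu^{(t)}(e^{i\theta})=c(t)\,d\psi(x),\qquad x=\cos(\theta/2),\quad 0\le\theta\le2\pi,$$ with a normalizing constant $c(t)$. (The minus sign only reflects that $x$ decreases from $1$ to $-1$ as $\theta$ increases from $0$ to $2\pi$: as positive measures, $\sin(\theta/2)\,d\mu^{(t)}$ is $c(t)$ times the image of $\psi$ under $x\mapsto e^{2i\arccos x}$.) Let $S_m^{(t)}$, $m\ge0$, be the monic orthogonal polynomials on the unit circle with respect to $\mu^{(t)}$, and let $a_{m-1}^{(t)}=-\overline{S_m^{(t)}(0)}$, $m\ge1$, be the associated Verblunsky coefficients. A parameter sequence of a sequence $(a_n)_{n\ge1}$ is a sequence $(g_n)_{n\ge0}$ with $0\le g_0<1$, $0<g_n<1$ and $a_n=(1-g_{n-1})g_n$ for $n\ge1$; if one exists, $(a_n)_{n\ge 1}$ is a positive chain sequence. The maximal parameter sequence is the one that is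 termwise at least every other one, and the minimal parameter sequence is the one with $g_0=0$. Then $\{\widehat\alpha_{m+1}\}_{m\ge1}$ has a maximal parameter sequence $\{M_m\}_{m\ge1}$, so that $\widehat\alpha_{m+1}=(1-M_m)M_{m+1}$ for $m\ge1$. The sequence defined by $\widetilde\alpha_1=(1-t)M_1$ and $\widetilde\alpha_{m+1}=\widehat\alpha_{m+1}$, $m\ge1$, has a minimal parameter sequence $\{\mathfrak m_m^{(t)}\}_{m\ge0}$. Moreover, for all $m\ge1$, $$a_{m-1}^{(t)}=\frac{1}{\tau_{m-1}}\,\frac{1-2\mathfrak m_m^{(t)}-i\widehat\beta_m}{1-i\widehat\beta_m},$$ where $\tau_0=1$ and $\tau_m=\dfrac{1-i\widehat\beta_m}{1+i\widehat\beta_m}\,\tau_{m-1}$ for $m\ge1$. -/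

import Mathlib

open MeasureTheory

noncomputable section

/-! ### The normalized orthogonal functions attached to `ψ` -/

/-- `∫ x F(x)² dψ(x) / ∫ F(x)² √(1-x²) dψ(x)`. -/
def betaRatio (ψ : Measure ℝ) (F : ℝ → ℝ) : ℝ :=
  (∫ x, x * F x ^ 2 ∂ψ) / (∫ x, F x ^ 2 * √(1 - x ^ 2) ∂ψ)

/-- With `b = betaRatio ψ G`:
`∫ [x - b √(1-x²)] F(x) G(x) √(1-x²) dψ(x) / ∫ F(x)² √(1-x²) dψ(x)`. -/
def alphaRatio (ψ : Measure ℝ) (F G : ℝ → ℝ) : ℝ :=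
  (∫ x, (x - betaRatio ψ G * √(1 - x ^ 2)) * F x * G x * √(1 - x ^ 2) ∂ψ) /
    (∫ x, F x ^ 2 * √(1 - x ^ 2) ∂ψ)

/-- The normalized functions `Ŵ_m`, given by their three term recurrence formula
`Ŵ_{m+1} = [x - β̂_{m+1} √(1-x²)] Ŵ_m - α̂_{m+1} Ŵ_{m-1}`. -/
def WHat (ψ : Measure ℝ) : ℕ → ℝ → ℝ
  | 0 => fun _ => 1
  | 1 => fun x => x - betaRatio ψ (fun _ => 1) * √(1 - x ^ 2)
  | m + 2 => fun x =>
      (x - betaRatio ψ (WHat ψ (m + 1)) * √(1 - x ^ 2)) * WHat ψ (m + 1) x -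
        alphaRatio ψ (WHat ψ m) (WHat ψ (m + 1)) * WHat ψ m x

/-- `ρ̂_m = ∫ Ŵ_m(x)² √(1-x²) dψ(x)`. -/
def rhoHat (ψ : Measure ℝ) (m : ℕ) : ℝ :=
  ∫ x, WHat ψ m x ^ 2 * √(1 - x ^ 2) ∂ψ

/-- The coefficients `β̂_m`, `m ≥ 1` (the value at `0` is never used). -/
def betaHat (ψ : Measure ℝ) : ℕ → ℝ
  | 0 => 0
  | m + 1 => (1 / rhoHat ψ m) * ∫ x, x * WHat ψ m x ^ 2 ∂ψ

/-- The coefficients `α̂_m`, `m ≥ 2` (the values at `0`, `1` are never used). -/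
def alphaHat (ψ : Measure ℝ) : ℕ → ℝ
  | 0 => 0
  | 1 => 0
  | m + 2 => (1 / rhoHat ψ m) *
      ∫ x, (x - betaHat ψ (m + 2) * √(1 - x ^ 2)) * WHat ψ m x * WHat ψ (m + 1) x *
        √(1 - x ^ 2) ∂ψ

/-- The normalized functions satisfy the recurrence with the coefficients `β̂`, `α̂`. -/
theorem WHat_one (ψ : Measure ℝ) (x : ℝ) :
    WHat ψ 1 x = x - betaHat ψ 1 * √(1 - x ^ 2) := by
  simp [WHat, betaHat, rhoHat, betaRatio, div_eq_inv_mul]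

theorem WHat_add_two (ψ : Measure ℝ) (m : ℕ) (x : ℝ) :
    WHat ψ (m + 2) x = (x - betaHat ψ (m + 2) * √(1 - x ^ 2)) * WHat ψ (m + 1) x -
      alphaHat ψ (m + 2) * WHat ψ m x := by
  simp only [WHat, betaHat, alphaHat, rhoHat, betaRatio, alphaRatio, div_eq_inv_mul, mul_one]

/-- `τ_0 = 1`, `τ_m = ((1 - iβ̂_m)/(1 + iβ̂_m)) τ_{m-1}`. -/
def tauSeq (ψ : Measure ℝ) : ℕ → ℂ
  | 0 => 1
  | m + 1 => (1 - Complex.I * (betaHat ψ (m + 1) : ℂ)) /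
      (1 + Complex.I * (betaHat ψ (m + 1) : ℂ)) * tauSeq ψ m

/-! ### Positive chain sequences -/

/-- `g = (g_n)_{n ≥ 0}` is a parameter sequence of the positive chain sequence `(a_n)_{n ≥ 1}`
(the value `a 0` plays no role). -/
structure IsParameterSequence (a g : ℕ → ℝ) : Prop where
  zero_nonneg : 0 ≤ g 0
  zero_lt_one : g 0 < 1
  pos : ∀ n, 1 ≤ n → 0 < g n
  lt_one : ∀ n, 1 ≤ n → g n < 1
  eq : ∀ n, a (n + 1) = (1 - g n) * g (n + 1)

/-- The maximal parameter sequence of `(a_n)_{n ≥ 1}`. -/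
def IsMaximalParameterSequence (a M : ℕ → ℝ) : Prop :=
  IsParameterSequence a M ∧ ∀ g, IsParameterSequence a g → ∀ n, g n ≤ M n

/-- The minimal parameter sequence of `(a_n)_{n ≥ 1}`: the one that starts with `0`. -/
def IsMinimalParameterSequence (a 𝔪 : ℕ → ℝ) : Prop :=
  IsParameterSequence a 𝔪 ∧ 𝔪 0 = 0

/-- The modified sequence `α̃_1 = (1 - t) M_1`, `α̃_{m+1} = α̂_{m+1}` for `m ≥ 1`
(the value at `0` is never used). -/
def alphaTilde (ψ : Measure ℝ) (t : ℝ) (M : ℕ → ℝ) : ℕ → ℝ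
  | 0 => 0
  | 1 => (1 - t) * M 1
  | m + 2 => alphaHat ψ (m + 2)

/-! ### Measures and orthogonal polynomials on the unit circle -/

/-- The angle `θ ∈ [0, 2π)` with `z = |z| e^{iθ}`. -/
def circleAngle (z : ℂ) : ℝ :=
  if 0 ≤ Complex.arg z then Complex.arg z else Complex.arg z + 2 * Real.pi

/-- `μ` is a probability measure on the unit circle that has mass `t` at `z = 1` and satisfies
`-sin(θ/2) dμ(e^{iθ}) = c dψ(x)`, `x = cos(θ/2)`, `0 ≤ θ ≤ 2π`, for a normalizing constant `c`.
The minus sign in the differential form accounts for `x` decreasing from `1` to `-1` while `θ`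
increases from `0` to `2π`; as positive measures, `sin(θ/2) dμ` is `c` times the image of `ψ`
under `x ↦ e^{iθ}`, `θ = 2 arccos x`. -/
structure IsCircleMeasure (ψ : Measure ℝ) (t : ℝ) (μ : Measure ℂ) : Prop where
  isProbabilityMeasure : IsProbabilityMeasure μ
  on_circle : μ (Metric.sphere (0 : ℂ) 1)ᶜ = 0
  jump : μ {1} = ENNReal.ofReal t
  relation : ∃ c : NNReal,
    μ.withDensity (fun z => ENNReal.ofReal (Real.sin (circleAngle z / 2))) =
      c • ψ.map (fun x => Complex.exp (((2 * Real.arccos x : ℝ) : ℂ) * Complex.I))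

/-- `S` is the sequence of monic orthogonal polynomials on the unit circle for `μ`. -/
def IsMonicOPUC (μ : Measure ℂ) (S : ℕ → Polynomial ℂ) : Prop :=
  ∀ m, (S m).Monic ∧ (S m).natDegree = m ∧
    ∀ k < m, ∫ z, starRingEnd ℂ (z ^ k) * (S m).eval z ∂μ = 0

/-- The Verblunsky coefficients `a_m = -conj (S_{m+1}(0))`, `m ≥ 0`. -/
def verblunsky (S : ℕ → Polynomial ℂ) (m : ℕ) : ℂ :=
  -starRingEnd ℂ ((S (m + 1)).eval 0)

end

/-!
Put `x = cos (θ/2)`, `e^{iθ/2} = x + i √(1-x²)` and `z = e^{iθ}`. Then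
`Ŵ_m(x) = e^{-imθ/2} R_m(z)` for a polynomial `R_m` of degree `m` (`kernelPoly`), so `Ŵ_m` is a
balanced Laurent polynomial of order `m`: a combination of `e^{ijθ/2}`, `j = -m, -m+2, …, m`.
The choice of `β̂` and `α̂` makes `Ŵ_{m+1}` orthogonal in `L²(ψ)` to all balanced functions of
order `m` (`moment_WHat_eq_zero`), and it yields
`α̂_{m+2} = ρ̂_{m+1} (1 + β̂_{m+2}²) / (ρ̂_m (1 + β̂_{m+1}²)) > 0` (`alphaHat_mul_eq`).

The circle measure `μ` is the image of the measure `ν = t δ_1 + c (1-x²)^{-1/2} dψ` on `[-1, 1]`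
(`exists_lineMeasure_map_eq`). Since `√(1-x²) dν = c dψ` and
`e^{i(j+2)θ/2} - e^{ijθ/2} = 2i √(1-x²) e^{i(j+1)θ/2}`, orthogonality with respect to `ψ` says that
the moments `∫ e^{ijθ/2} Ŵ_m dν`, `j = -m, -m+2, …, m`, have a common value `e_m`
(`moment_WHat_eq_kernelMean`). Hence `∫ f Ŵ_m dν = f(1) e_m` for balanced `f` of order `m`, that is,
`Ŵ_m` is up to a factor the reproducing kernel at `z = 1`.

Three consequences give the theorem.
* Both `e_m` and `Ŵ_m(1)` solve `y_{m+2} = y_{m+1} - α̂_{m+2} y_m`. Their Casorati determinant is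
  positive, and so is `γ_m = e_m / e_{m-1}`, because `‖e^{iθ/2} Ŵ_m - γ_m Ŵ_{m-1}‖²` in `L²(ν)` is
  `γ_m` times that determinant (`kernelMean_div_pos`). Therefore `g_m = 1 - γ_m` is a parameter
  sequence of `(α̂_{m+1})`. As `g_1 = c ρ̂_0 (1 + β̂_1²)` and `c` is proportional to `1 - t`, the
  value `g_1` for `t` is `1 - t` times the one for `t = 0`.
* For `t = 0` the sequence is maximal (`isMaximalParameterSequence_chainParam`): testing the
  extremal property of the kernel on `x^m` gives `e_m / Ŵ_m(1) ≤ ∫ x^{2m} dν → 0`, whereas a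
  parameter sequence with a larger first term would keep `e_m / Ŵ_m(1)` away from `0`.
* `R_m - γ_m R_{m-1}` is orthogonal to `1, z, …, z^{m-1}` with respect to `μ`, so it is a multiple
  of `S_m` (`kernelLead_mul_eq`), and its value at `z = 0` gives the Verblunsky coefficient.
-/

noncomputable section

namespace VerblunskyChain

open Polynomial

/-! ### The upper unit semicircle -/

/-- The point `e^{iθ/2} = x + i √(1-x²)` of the upper unit semicircle above `x = cos (θ/2)`. It has
modulus one only for `x ∈ [-1, 1]`, but is nonzero and continuous everywhere. -/
def halfPoint (x : ℝ) : ℂ := x + √(1 - x ^ 2) * Complex.I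

lemma one_sub_sq_nonneg {x : ℝ} (hx : x ∈ Set.Icc (-1 : ℝ) 1) : 0 ≤ 1 - x ^ 2 := by
  nlinarith [hx.1, hx.2]

lemma sq_sqrt_one_sub {x : ℝ} (hx : x ∈ Set.Icc (-1 : ℝ) 1) : √(1 - x ^ 2) ^ 2 = 1 - x ^ 2 :=
  Real.sq_sqrt (one_sub_sq_nonneg hx)

lemma halfPoint_re (x : ℝ) : (halfPoint x).re = x := by simp [halfPoint]

lemma halfPoint_im (x : ℝ) : (halfPoint x).im = √(1 - x ^ 2) := by simp [halfPoint]

lemma halfPoint_injective : Function.Injective halfPoint := fun x y h => by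
  rw [← halfPoint_re x, h, halfPoint_re]

lemma halfPoint_one : halfPoint 1 = 1 := by simp [halfPoint]

lemma continuous_halfPoint : Continuous halfPoint := by
  unfold halfPoint; fun_prop

lemma halfPoint_ne_zero (x : ℝ) : halfPoint x ≠ 0 := by
  intro h
  have h1 := congrArg Complex.re h
  have h2 := congrArg Complex.im h
  rw [halfPoint_re, Complex.zero_re] at h1
  rw [halfPoint_im, h1] at h2
  simp at h2

lemma halfPoint_mul_conj {x : ℝ} (hx : x ∈ Set.Icc (-1 : ℝ) 1) :
    halfPoint x * starRingEnd ℂ (halfPoint x) = 1 := by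
  rw [Complex.mul_conj, Complex.normSq_apply, halfPoint_re, halfPoint_im, ← sq, ← sq,
    sq_sqrt_one_sub hx]
  norm_num

lemma conj_halfPoint {x : ℝ} (hx : x ∈ Set.Icc (-1 : ℝ) 1) :
    starRingEnd ℂ (halfPoint x) = (halfPoint x)⁻¹ :=
  eq_inv_of_mul_eq_one_right (halfPoint_mul_conj hx)

lemma norm_halfPoint {x : ℝ} (hx : x ∈ Set.Icc (-1 : ℝ) 1) : ‖halfPoint x‖ = 1 := by
  have h := congrArg norm (halfPoint_mul_conj hx)
  rw [norm_mul, RCLike.norm_conj, norm_one] at h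
  nlinarith [norm_nonneg (halfPoint x)]

lemma ofReal_mul_halfPoint {x : ℝ} (hx : x ∈ Set.Icc (-1 : ℝ) 1) :
    (x : ℂ) * halfPoint x = (halfPoint x ^ 2 + 1) / 2 := by
  have h : ((√(1 - x ^ 2) : ℝ) : ℂ) ^ 2 = 1 - (x : ℂ) ^ 2 := by
    exact_mod_cast congrArg (fun y : ℝ => (y : ℂ)) (sq_sqrt_one_sub hx)
  unfold halfPoint
  linear_combination (1/2 : ℂ) * h - (1/2) * ((√(1 - x ^ 2) : ℝ) : ℂ) ^ 2 * Complex.I_sq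

lemma sqrt_mul_halfPoint {x : ℝ} (hx : x ∈ Set.Icc (-1 : ℝ) 1) :
    ((√(1 - x ^ 2) : ℝ) : ℂ) * halfPoint x = (halfPoint x ^ 2 - 1) / 2 * -Complex.I := by
  have h : ((√(1 - x ^ 2) : ℝ) : ℂ) ^ 2 = 1 - (x : ℂ) ^ 2 := by
    exact_mod_cast congrArg (fun y : ℝ => (y : ℂ)) (sq_sqrt_one_sub hx)
  unfold halfPoint
  linear_combination (Complex.I/2 : ℂ) * h + (((√(1 - x ^ 2) : ℝ) : ℂ) * x +
    (1/2) * Complex.I * ((√(1 - x ^ 2) : ℝ) : ℂ) ^ 2) * Complex.I_sq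

/-! ### Integration over `[-1, 1]` -/

lemma ae_mem_Icc {κ : Measure ℝ} (hκ : κ (Set.Icc (-1) 1)ᶜ = 0) :
    ∀ᵐ x ∂κ, x ∈ Set.Icc (-1 : ℝ) 1 :=
  measure_eq_zero_iff_ae_notMem.1 hκ |>.mono fun _ hx => not_not.1 hx

lemma integrable_of_continuous {E : Type*} [NormedAddCommGroup E] {κ : Measure ℝ}
    [IsFiniteMeasure κ] (hκ : κ (Set.Icc (-1) 1)ᶜ = 0) {f : ℝ → E} (hf : Continuous f) :
    Integrable f κ := by
  have h : κ.restrict (Set.Icc (-1) 1) = κ :=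
    Measure.restrict_eq_self_of_ae_mem (ae_mem_Icc hκ)
  rw [← h]
  exact (hf.continuousOn).integrableOn_compact isCompact_Icc

/-- A nonnegative continuous function with finitely many zeros in `[-1, 1]` has a positive integral
against every measure that dominates a measure of infinite support. -/
lemma integral_pos_of_finite_zeros {ψ κ : Measure ℝ} [IsFiniteMeasure κ]
    (hsupp : ψ (Set.Icc (-1) 1)ᶜ = 0) (hinf : ∀ s : Set ℝ, s.Finite → ψ sᶜ ≠ 0)
    (hκ : κ (Set.Icc (-1) 1)ᶜ = 0) (hac : ψ ≪ κ) {f : ℝ → ℝ} (hf : Continuous f)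
    (h0 : ∀ x, 0 ≤ f x) (hfin : {x | x ∈ Set.Icc (-1 : ℝ) 1 ∧ f x = 0}.Finite) :
    0 < ∫ x, f x ∂κ := by
  refine lt_of_le_of_ne (integral_nonneg h0) fun h => ?_
  have h1 := (integral_eq_zero_iff_of_nonneg h0 (integrable_of_continuous hκ hf)).1 h.symm
  have h2 : f =ᵐ[ψ] 0 := hac.ae_le h1
  refine hinf _ hfin ?_
  rw [← mem_ae_iff]
  filter_upwards [h2, ae_mem_Icc hsupp] with x hx hx'
  exact ⟨hx', hx⟩

/-- A nonzero polynomial in `e^{iθ}` vanishes at finitely many `x = cos (θ/2)`. -/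
lemma finite_zeros_eval_sq {p : ℂ[X]} (hp : p ≠ 0) :
    {x : ℝ | p.eval (halfPoint x ^ 2) = 0}.Finite := by
  have hq : p.comp (X ^ 2) ≠ 0 := by
    intro h
    rcases Polynomial.comp_eq_zero_iff.1 h with h | h
    · exact hp h
    · have := congrArg natDegree h.2
      simp at this
  have := ((p.comp (X ^ 2)).finite_setOfPred_isRoot hq).preimage halfPoint_injective.injOn
  refine this.subset fun x hx => ?_
  simpa [IsRoot] using hx

/-! ### Balanced Laurent polynomials in `e^{iθ/2}` -/

/-- `f` agrees on `[-1, 1]` with a combination of the powers `e^{ijθ/2}`, `j = -m, -m+2, …, m`. -/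
def IsBalanced (m : ℕ) (f : ℝ → ℂ) : Prop :=
  ∃ p : ℂ[X], p.natDegree ≤ m ∧
    ∀ x ∈ Set.Icc (-1 : ℝ) 1, halfPoint x ^ m * f x = p.eval (halfPoint x ^ 2)

lemma IsBalanced.ofReal_mul {m : ℕ} {f : ℝ → ℂ} (hf : IsBalanced m f) :
    IsBalanced (m + 1) fun x => x * f x := by
  obtain ⟨p, hp, h⟩ := hf
  refine ⟨C (1/2) * (X + 1) * p, ?_, fun x hx => ?_⟩
  · compute_degree
    omega
  · simp only [eval_mul, eval_C, eval_add, eval_X, eval_one, ← h x hx]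
    linear_combination halfPoint x ^ m * f x * ofReal_mul_halfPoint hx

lemma IsBalanced.sqrt_mul {m : ℕ} {f : ℝ → ℂ} (hf : IsBalanced m f) :
    IsBalanced (m + 1) fun x => (√(1 - x ^ 2) : ℝ) * f x := by
  obtain ⟨p, hp, h⟩ := hf
  refine ⟨C (-Complex.I/2) * (X - 1) * p, ?_, fun x hx => ?_⟩
  · compute_degree
    omega
  · simp only [eval_mul, eval_C, eval_sub, eval_X, eval_one, ← h x hx]
    linear_combination halfPoint x ^ m * f x * sqrt_mul_halfPoint hx

lemma IsBalanced.add_two {m : ℕ} {f : ℝ → ℂ} (hf : IsBalanced m f) :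
    IsBalanced (m + 2) f := by
  obtain ⟨p, hp, h⟩ := hf
  refine ⟨X * p, ?_, fun x hx => ?_⟩
  · compute_degree
    omega
  · simp only [eval_mul, eval_X, ← h x hx]
    ring

lemma isBalanced_pow (m : ℕ) : IsBalanced m fun x => (x : ℂ) ^ m := by
  induction m with
  | zero => exact ⟨1, by simp, by simp⟩
  | succ m ih => simpa only [pow_succ'] using ih.ofReal_mul

/-- The `j`-th half-angle moment `∫ e^{ijθ/2} F(x) dκ(x)`. -/
def moment (κ : Measure ℝ) (F : ℝ → ℝ) (j : ℤ) : ℂ := ∫ x, halfPoint x ^ j * (F x : ℂ) ∂κ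

lemma continuous_halfPoint_zpow (j : ℤ) : Continuous fun x => halfPoint x ^ j :=
  continuous_halfPoint.zpow₀ j fun x => Or.inl (halfPoint_ne_zero x)

lemma integrable_moment {κ : Measure ℝ} [IsFiniteMeasure κ] (hκ : κ (Set.Icc (-1) 1)ᶜ = 0)
    {F : ℝ → ℝ} (hF : Continuous F) (j : ℤ) :
    Integrable (fun x => halfPoint x ^ j * (F x : ℂ)) κ :=
  integrable_of_continuous hκ
    ((continuous_halfPoint_zpow j).mul (Complex.continuous_ofReal.comp hF))

lemma conj_moment {κ : Measure ℝ} (hκ : κ (Set.Icc (-1) 1)ᶜ = 0) (F : ℝ → ℝ) (j : ℤ) :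
    starRingEnd ℂ (moment κ F j) = moment κ F (-j) := by
  rw [moment, ← integral_conj, moment]
  refine integral_congr_ae ?_
  filter_upwards [ae_mem_Icc hκ] with x hx
  simp only [map_mul, Complex.conj_ofReal, map_zpow₀, conj_halfPoint hx, inv_zpow', zpow_neg]

/-- The integral of a balanced function against `F`, expanded in moments. -/
lemma integral_mul_eq_sum_moment {κ : Measure ℝ} [IsFiniteMeasure κ]
    (hκ : κ (Set.Icc (-1) 1)ᶜ = 0) {F : ℝ → ℝ} (hF : Continuous F) {m : ℕ} {f : ℝ → ℂ} {p : ℂ[X]}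
    (hp : p.natDegree ≤ m)
    (h : ∀ x ∈ Set.Icc (-1 : ℝ) 1, halfPoint x ^ m * f x = p.eval (halfPoint x ^ 2)) :
    ∫ x, f x * (F x : ℂ) ∂κ = ∑ k ∈ Finset.range (m + 1), p.coeff k * moment κ F (2 * k - m) := by
  simp only [moment, ← integral_const_mul]
  rw [← integral_finsetSum _ fun k _ => (integrable_moment hκ hF _).const_mul _]
  refine integral_congr_ae ?_
  filter_upwards [ae_mem_Icc hκ] with x hx
  have hx0 := halfPoint_ne_zero x
  refine mul_left_cancel₀ (pow_ne_zero m hx0) ?_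
  rw [← mul_assoc, h x hx, eval_eq_sum_range' (Nat.lt_succ_of_le hp), Finset.sum_mul,
    Finset.mul_sum]
  refine Finset.sum_congr rfl fun k _ => ?_
  rw [zpow_sub₀ hx0, zpow_mul, zpow_natCast, zpow_natCast, zpow_ofNat]
  field_simp

/-- If the moments of `F` of index `-m, -m+2, …, m` have the common value `v`, then integration
against `F` is `v` times evaluation at `x = 1` on balanced functions. -/
lemma IsBalanced.integral_mul {κ : Measure ℝ} [IsFiniteMeasure κ]
    (hκ : κ (Set.Icc (-1) 1)ᶜ = 0) {F : ℝ → ℝ} (hF : Continuous F) {m : ℕ} {f : ℝ → ℂ}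
    (hf : IsBalanced m f) {v : ℂ} (hv : ∀ k : ℕ, k ≤ m → moment κ F (2 * k - m) = v) :
    ∫ x, f x * (F x : ℂ) ∂κ = f 1 * v := by
  obtain ⟨p, hp, h⟩ := hf
  have h1 := h 1 (by norm_num)
  rw [halfPoint_one, one_pow, one_pow, one_mul, eval_eq_sum_range' (Nat.lt_succ_of_le hp)] at h1
  rw [integral_mul_eq_sum_moment hκ hF hp h, h1, Finset.sum_mul]
  refine Finset.sum_congr rfl fun k hk => ?_
  rw [hv k (Nat.lt_succ_iff.1 (Finset.mem_range.1 hk)), one_pow, mul_one]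

/-! ### The functions `Ŵ_m` and their orthogonality -/

/-- The recurrence in one piece; for `m = 0` the last term drops out because `α̂_1 = 0`. -/
lemma WHat_succ (ψ : Measure ℝ) (m : ℕ) (x : ℝ) :
    WHat ψ (m + 1) x = (x - betaHat ψ (m + 1) * √(1 - x ^ 2)) * WHat ψ m x -
      alphaHat ψ (m + 1) * WHat ψ (m - 1) x := by
  cases m with
  | zero => rw [zero_add, WHat_one]; simp [alphaHat, WHat]
  | succ m => exact WHat_add_two ψ m x

lemma continuous_WHat (ψ : Measure ℝ) (m : ℕ) : Continuous (WHat ψ m) := by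
  induction m using Nat.twoStepInduction with
  | zero => exact continuous_const
  | one => simp only [funext (WHat_one ψ)]; fun_prop
  | more m h0 h1 => simp only [funext (WHat_add_two ψ m)]; fun_prop

/-- The polynomial `R_m` with `Ŵ_m(x) = e^{-imθ/2} R_m(e^{iθ})`. -/
def kernelPoly (ψ : Measure ℝ) : ℕ → ℂ[X]
  | 0 => 1
  | 1 => C ((1 + Complex.I * betaHat ψ 1) / 2) * X + C ((1 - Complex.I * betaHat ψ 1) / 2)
  | m + 2 => (C ((1 + Complex.I * betaHat ψ (m + 2)) / 2) * X +
        C ((1 - Complex.I * betaHat ψ (m + 2)) / 2)) * kernelPoly ψ (m + 1) -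
      C (alphaHat ψ (m + 2) : ℂ) * (X * kernelPoly ψ m)

/-- `L_m = ∏_{k ≤ m} (1 + iβ̂_k) / 2`, the coefficient of `z^m` in `R_m`. -/
def kernelLead (ψ : Measure ℝ) : ℕ → ℂ
  | 0 => 1
  | m + 1 => (1 + Complex.I * betaHat ψ (m + 1)) / 2 * kernelLead ψ m

lemma one_add_I_mul_ne_zero (b : ℝ) : 1 + Complex.I * (b : ℂ) ≠ 0 := fun h => by
  simpa using congrArg Complex.re h

lemma one_sub_I_mul_ne_zero (b : ℝ) : 1 - Complex.I * (b : ℂ) ≠ 0 := fun h => by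
  simpa using congrArg Complex.re h

lemma kernelLead_ne_zero (ψ : Measure ℝ) (m : ℕ) : kernelLead ψ m ≠ 0 := by
  induction m with
  | zero => exact one_ne_zero
  | succ m ih => exact mul_ne_zero (div_ne_zero (one_add_I_mul_ne_zero _) two_ne_zero) ih

lemma natDegree_kernelPoly_le (ψ : Measure ℝ) (m : ℕ) : (kernelPoly ψ m).natDegree ≤ m := by
  induction m using Nat.twoStepInduction with
  | zero => simp [kernelPoly]
  | one => exact natDegree_linear_le
  | more m h0 h1 =>
    rw [kernelPoly]
    refine (natDegree_sub_le _ _).trans (max_le ?_ ?_)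
    · exact natDegree_mul_le.trans ((add_le_add natDegree_linear_le h1).trans (by omega))
    · refine (natDegree_C_mul_le _ _).trans (natDegree_mul_le.trans ?_)
      exact (add_le_add natDegree_X_le h0).trans (by omega)

lemma coeff_kernelPoly (ψ : Measure ℝ) (m : ℕ) : (kernelPoly ψ m).coeff m = kernelLead ψ m := by
  induction m using Nat.twoStepInduction with
  | zero => simp [kernelPoly, kernelLead]
  | one => simp [kernelPoly, kernelLead, coeff_C]
  | more m h0 h1 =>
    have h2 : (kernelPoly ψ (m + 1)).coeff (m + 2) = 0 :=
      coeff_eq_zero_of_natDegree_lt ((natDegree_kernelPoly_le ψ (m + 1)).trans_lt (by omega))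
    have h3 : (kernelPoly ψ m).coeff (m + 1) = 0 :=
      coeff_eq_zero_of_natDegree_lt ((natDegree_kernelPoly_le ψ m).trans_lt (by omega))
    rw [kernelPoly, coeff_sub, add_mul, coeff_add, mul_assoc, coeff_C_mul, coeff_C_mul,
      coeff_C_mul, coeff_X_mul, coeff_X_mul, h1, h2, h3, kernelLead.eq_2 ψ (m + 1)]
    ring

lemma kernelPoly_ne_zero (ψ : Measure ℝ) (m : ℕ) : kernelPoly ψ m ≠ 0 := fun h => by
  have := coeff_kernelPoly ψ m
  rw [h, coeff_zero] at this
  exact kernelLead_ne_zero ψ m this.symm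

lemma kernelPoly_eval_zero (ψ : Measure ℝ) (m : ℕ) :
    (kernelPoly ψ m).eval 0 = starRingEnd ℂ (kernelLead ψ m) := by
  induction m using Nat.twoStepInduction with
  | zero => simp [kernelPoly, kernelLead]
  | one => simp [kernelPoly, kernelLead, sub_eq_add_neg, map_ofNat]
  | more m h0 h1 =>
    rw [kernelLead.eq_2 ψ (m + 1), map_mul, ← h1]
    simp [kernelPoly, sub_eq_add_neg, map_ofNat]

lemma halfPoint_pow_mul_WHat (ψ : Measure ℝ) (m : ℕ) {x : ℝ} (hx : x ∈ Set.Icc (-1 : ℝ) 1) :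
    halfPoint x ^ m * (WHat ψ m x : ℂ) = (kernelPoly ψ m).eval (halfPoint x ^ 2) := by
  have hc := ofReal_mul_halfPoint hx
  have hs := sqrt_mul_halfPoint hx
  induction m using Nat.twoStepInduction with
  | zero => simp [kernelPoly, WHat]
  | one =>
    rw [WHat_one]
    simp only [kernelPoly, eval_add, eval_mul, eval_C, eval_X]
    push_cast
    linear_combination hc - (betaHat ψ 1 : ℂ) * hs
  | more m h0 h1 =>
    rw [WHat_add_two]
    simp only [kernelPoly, eval_add, eval_sub, eval_mul, eval_C, eval_X, ← h0, ← h1]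
    push_cast
    linear_combination halfPoint x ^ (m + 1) * (WHat ψ (m + 1) x : ℂ) *
      (hc - (betaHat ψ (m + 2) : ℂ) * hs)

lemma isBalanced_WHat (ψ : Measure ℝ) (m : ℕ) : IsBalanced m fun x => (WHat ψ m x : ℂ) :=
  ⟨kernelPoly ψ m, natDegree_kernelPoly_le ψ m, fun _ hx => halfPoint_pow_mul_WHat ψ m hx⟩

lemma finite_zeros_WHat (ψ : Measure ℝ) (m : ℕ) :
    {x | x ∈ Set.Icc (-1 : ℝ) 1 ∧ WHat ψ m x = 0}.Finite := by
  refine (finite_zeros_eval_sq (kernelPoly_ne_zero ψ m)).subset fun x hx => ?_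
  have := halfPoint_pow_mul_WHat ψ m hx.1
  rw [hx.2, Complex.ofReal_zero, mul_zero] at this
  exact this.symm

lemma finite_zeros_WHat_mul_sqrt (ψ : Measure ℝ) (m : ℕ) :
    {x | x ∈ Set.Icc (-1 : ℝ) 1 ∧ WHat ψ m x * √(1 - x ^ 2) = 0}.Finite := by
  refine ((finite_zeros_WHat ψ m).union (Set.toFinite {-1, 1})).subset fun x hx => ?_
  rcases mul_eq_zero.1 hx.2 with h | h
  · exact Or.inl ⟨hx.1, h⟩
  · right
    have h1 : x ^ 2 = 1 := by
      have := Real.sqrt_eq_zero (one_sub_sq_nonneg hx.1) |>.1 h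
      linarith
    rcases sq_eq_one_iff.1 h1 with h | h <;> simp [h]

lemma rhoHat_pos {ψ : Measure ℝ} [IsFiniteMeasure ψ] (hsupp : ψ (Set.Icc (-1) 1)ᶜ = 0)
    (hinf : ∀ s : Set ℝ, s.Finite → ψ sᶜ ≠ 0) (m : ℕ) : 0 < rhoHat ψ m := by
  have hW := continuous_WHat ψ m
  refine integral_pos_of_finite_zeros hsupp hinf hsupp Measure.AbsolutelyContinuous.rfl
    (by fun_prop) (fun x => by positivity)
    ((finite_zeros_WHat_mul_sqrt ψ m).subset fun x hx => ⟨hx.1, ?_⟩)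
  rcases mul_eq_zero.1 hx.2 with h | h
  · rw [pow_eq_zero_iff two_ne_zero |>.1 h, zero_mul]
  · rw [h, mul_zero]

/-- The moments of `Ŵ_{m+1}`: the three-term recurrence. -/
lemma moment_WHat_succ {ψ κ : Measure ℝ} [IsFiniteMeasure κ] (hκ : κ (Set.Icc (-1) 1)ᶜ = 0)
    (m : ℕ) (j : ℤ) :
    moment κ (WHat ψ (m + 1)) j =
      (1 + Complex.I * betaHat ψ (m + 1)) / 2 * moment κ (WHat ψ m) (j + 1) +
      (1 - Complex.I * betaHat ψ (m + 1)) / 2 * moment κ (WHat ψ m) (j - 1) -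
      alphaHat ψ (m + 1) * moment κ (WHat ψ (m - 1)) j := by
  have i1 := integrable_moment hκ (continuous_WHat ψ m) (j + 1)
  have i2 := integrable_moment hκ (continuous_WHat ψ m) (j - 1)
  have i3 := integrable_moment hκ (continuous_WHat ψ (m - 1)) j
  simp only [moment, ← integral_const_mul]
  rw [← integral_add (i1.const_mul _) (i2.const_mul _)]
  refine Eq.trans ?_ (integral_sub ((i1.const_mul _).add (i2.const_mul _)) (i3.const_mul _))
  refine integral_congr_ae ?_
  filter_upwards [ae_mem_Icc hκ] with x hx
  have hx0 := halfPoint_ne_zero x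
  have hc := ofReal_mul_halfPoint hx
  have hs := sqrt_mul_halfPoint hx
  have hj : halfPoint x ^ j = halfPoint x ^ (j - 1) * halfPoint x := by
    rw [← zpow_add_one₀ hx0, sub_add_cancel]
  have hj1 : halfPoint x ^ (j + 1) = halfPoint x ^ (j - 1) * halfPoint x ^ 2 := by
    rw [zpow_add_one₀ hx0, hj]; ring
  rw [WHat_succ, hj1, hj]
  push_cast
  linear_combination halfPoint x ^ (j - 1) * (WHat ψ m x : ℂ) *
      (hc - (betaHat ψ (m + 1) : ℂ) * hs)

/-- A real-valued form of `IsBalanced.integral_mul` with common moment `0`. -/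
lemma IsBalanced.integral_ofReal_mul_eq_zero {κ : Measure ℝ} [IsFiniteMeasure κ]
    (hκ : κ (Set.Icc (-1) 1)ᶜ = 0) {F : ℝ → ℝ} (hF : Continuous F) {m : ℕ} {f : ℝ → ℝ}
    (hf : IsBalanced m fun x => (f x : ℂ))
    (hv : ∀ k : ℕ, k ≤ m → moment κ F (2 * k - m) = 0) : ∫ x, f x * F x ∂κ = 0 := by
  have := hf.integral_mul hκ hF hv
  rw [mul_zero] at this
  simp only [← Complex.ofReal_mul, integral_complex_ofReal] at this
  exact_mod_cast this

/-- The choice of `β̂_{m+1}`. -/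
lemma integral_mul_WHat_sq {ψ : Measure ℝ} [IsFiniteMeasure ψ]
    (hsupp : ψ (Set.Icc (-1) 1)ᶜ = 0) (hinf : ∀ s : Set ℝ, s.Finite → ψ sᶜ ≠ 0) (m : ℕ) :
    ∫ x, x * WHat ψ m x ^ 2 ∂ψ = betaHat ψ (m + 1) * rhoHat ψ m := by
  have := (rhoHat_pos hsupp hinf m).ne'
  rw [betaHat]
  field_simp

/-- The choice of `α̂_{m+2}`. -/
lemma integral_WHat_add_two_mul_sqrt_mul {ψ : Measure ℝ} [IsFiniteMeasure ψ]
    (hsupp : ψ (Set.Icc (-1) 1)ᶜ = 0) (hinf : ∀ s : Set ℝ, s.Finite → ψ sᶜ ≠ 0) (m : ℕ) :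
    ∫ x, √(1 - x ^ 2) * WHat ψ m x * WHat ψ (m + 2) x ∂ψ = 0 := by
  have h0 := continuous_WHat ψ m
  have h1 := continuous_WHat ψ (m + 1)
  have h : ∀ x, √(1 - x ^ 2) * WHat ψ m x * WHat ψ (m + 2) x =
      (x - betaHat ψ (m + 2) * √(1 - x ^ 2)) * WHat ψ m x * WHat ψ (m + 1) x * √(1 - x ^ 2) -
      alphaHat ψ (m + 2) * (WHat ψ m x ^ 2 * √(1 - x ^ 2)) := fun x => by
    rw [WHat_add_two]; ring
  simp only [h]
  rw [integral_sub (integrable_of_continuous hsupp (by fun_prop))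
    (integrable_of_continuous hsupp (by fun_prop)), integral_const_mul, alphaHat,
    show ∫ x, WHat ψ m x ^ 2 * √(1 - x ^ 2) ∂ψ = rhoHat ψ m from rfl]
  have := (rhoHat_pos hsupp hinf m).ne'
  field_simp
  ring

/-- The extreme moment of `Ŵ_{m+2}` vanishes, once it is orthogonal to all lower ones: test against
`e^{iθ/2} Ŵ_m = x Ŵ_m + i √(1-x²) Ŵ_m`, whose leading coefficient is nonzero. The second part is
orthogonal to `Ŵ_{m+2}` by the choice of `α̂`, the first by the choice of `β̂`. -/
lemma moment_WHat_extreme {ψ : Measure ℝ} [IsFiniteMeasure ψ]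
    (hsupp : ψ (Set.Icc (-1) 1)ᶜ = 0) (hinf : ∀ s : Set ℝ, s.Finite → ψ sᶜ ≠ 0) (m : ℕ)
    (horth : ∀ k : ℕ, k ≤ m → moment ψ (WHat ψ (m + 1)) (2 * k - m) = 0)
    (hinner : ∀ k : ℕ, k < m → moment ψ (WHat ψ (m + 2)) (2 * k + 1 - m) = 0) :
    moment ψ (WHat ψ (m + 2)) (m + 1) = 0 := by
  have c0 := continuous_WHat ψ m
  have c1 := continuous_WHat ψ (m + 1)
  have c2 := continuous_WHat ψ (m + 2)
  have cp := continuous_WHat ψ (m - 1)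
  have hs := integral_WHat_add_two_mul_sqrt_mul hsupp hinf m
  have h01 : ∫ x, WHat ψ m x * WHat ψ (m + 1) x ∂ψ = 0 :=
    (isBalanced_WHat ψ m).integral_ofReal_mul_eq_zero hsupp c1 horth
  have h12 : ∫ x, WHat ψ (m + 1) x * WHat ψ (m + 2) x ∂ψ = 0 := by
    have h : ∀ x, WHat ψ (m + 1) x * WHat ψ (m + 2) x =
        x * WHat ψ (m + 1) x ^ 2 - betaHat ψ (m + 2) * (WHat ψ (m + 1) x ^ 2 * √(1 - x ^ 2)) -
        alphaHat ψ (m + 2) * (WHat ψ m x * WHat ψ (m + 1) x) := fun x => by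
      rw [WHat_add_two]; ring
    simp only [h]
    rw [integral_sub (integrable_of_continuous hsupp (by fun_prop))
      (integrable_of_continuous hsupp (by fun_prop)),
      integral_sub (integrable_of_continuous hsupp (by fun_prop))
      (integrable_of_continuous hsupp (by fun_prop)), integral_const_mul, integral_const_mul, h01,
      integral_mul_WHat_sq hsupp hinf,
      show ∫ x, WHat ψ (m + 1) x ^ 2 * √(1 - x ^ 2) ∂ψ = rhoHat ψ (m + 1) from rfl]
    ring
  have hp2 : alphaHat ψ (m + 1) * ∫ x, WHat ψ (m - 1) x * WHat ψ (m + 2) x ∂ψ = 0 := by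
    cases m with
    | zero => simp [alphaHat]
    | succ n =>
      rw [Nat.add_sub_cancel, (isBalanced_WHat ψ n).integral_ofReal_mul_eq_zero hsupp c2
        fun k hk => ?_, mul_zero]
      rw [← hinner k (by omega)]
      congr 1
      push_cast
      ring
  have hx : ∫ x, x * WHat ψ m x * WHat ψ (m + 2) x ∂ψ = 0 := by
    have h : ∀ x, x * WHat ψ m x * WHat ψ (m + 2) x = WHat ψ (m + 1) x * WHat ψ (m + 2) x +
        betaHat ψ (m + 1) * (√(1 - x ^ 2) * WHat ψ m x * WHat ψ (m + 2) x) +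
        alphaHat ψ (m + 1) * (WHat ψ (m - 1) x * WHat ψ (m + 2) x) := fun x => by
      rw [WHat_succ ψ m]; ring
    simp only [h]
    rw [integral_add (integrable_of_continuous hsupp (by fun_prop))
      (integrable_of_continuous hsupp (by fun_prop)),
      integral_add (integrable_of_continuous hsupp (by fun_prop))
      (integrable_of_continuous hsupp (by fun_prop)), integral_const_mul, integral_const_mul,
      h12, hs, hp2]
    ring
  have htest : ∫ x, halfPoint x * (WHat ψ m x : ℂ) * (WHat ψ (m + 2) x : ℂ) ∂ψ = 0 := by
    have h : ∀ x, halfPoint x * (WHat ψ m x : ℂ) * (WHat ψ (m + 2) x : ℂ) =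
        ((x * WHat ψ m x * WHat ψ (m + 2) x : ℝ) : ℂ) +
        ((√(1 - x ^ 2) * WHat ψ m x * WHat ψ (m + 2) x : ℝ) : ℂ) * Complex.I := fun x => by
      rw [halfPoint]; push_cast; ring
    simp only [h]
    rw [integral_add (integrable_of_continuous hsupp (by fun_prop))
      (integrable_of_continuous hsupp (by fun_prop)), integral_mul_const, integral_complex_ofReal,
      integral_complex_ofReal, hx, hs]
    simp
  have hexp := integral_mul_eq_sum_moment (p := X * kernelPoly ψ m) (m := m + 1)
    (f := fun x => halfPoint x * (WHat ψ m x : ℂ)) hsupp c2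
    (natDegree_mul_le.trans ((add_le_add natDegree_X_le (natDegree_kernelPoly_le ψ m)).trans
      (by omega)))
    (fun x hx => by
      rw [eval_mul, eval_X, ← halfPoint_pow_mul_WHat ψ m hx]; ring)
  rw [htest, Finset.sum_range_succ, Finset.sum_range_succ', Finset.sum_eq_zero, coeff_X_mul,
    coeff_kernelPoly] at hexp
  · simp only [coeff_X_mul_zero, zero_mul, zero_add] at hexp
    have := (mul_eq_zero.1 hexp.symm).resolve_left (kernelLead_ne_zero ψ m)
    rw [← this]
    congr 1
    push_cast
    ring
  · intro k hk
    have := hinner k (Finset.mem_range.1 hk)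
    rw [show (2 * ((k + 1 : ℕ) : ℤ) - ((m + 1 : ℕ) : ℤ)) = 2 * k + 1 - m by push_cast; ring, this,
      mul_zero]

/-- `Ŵ_{m+1}` is orthogonal in `L²(ψ)` to `e^{ijθ/2}` for `j = -m, -m+2, …, m`. -/
theorem moment_WHat_eq_zero {ψ : Measure ℝ} [IsFiniteMeasure ψ]
    (hsupp : ψ (Set.Icc (-1) 1)ᶜ = 0) (hinf : ∀ s : Set ℝ, s.Finite → ψ sᶜ ≠ 0) (m : ℕ) :
    ∀ k : ℕ, k ≤ m → moment ψ (WHat ψ (m + 1)) (2 * k - m) = 0 := by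
  induction m using Nat.strong_induction_on with
  | _ m ih =>
  cases m with
  | zero =>
    intro k hk
    obtain rfl : k = 0 := by omega
    have h : ∀ x, WHat ψ 1 x = x * WHat ψ 0 x ^ 2 -
        betaHat ψ 1 * (WHat ψ 0 x ^ 2 * √(1 - x ^ 2)) := fun x => by
      rw [WHat_one]; simp [WHat]
    have c0 := continuous_WHat ψ 0
    simp only [moment, Nat.cast_zero, mul_zero, sub_zero, zpow_zero, one_mul, zero_add, h]
    rw [integral_complex_ofReal, integral_sub (integrable_of_continuous hsupp (by fun_prop))
      (integrable_of_continuous hsupp (by fun_prop)), integral_const_mul,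
      integral_mul_WHat_sq hsupp hinf,
      show ∫ x, WHat ψ 0 x ^ 2 * √(1 - x ^ 2) ∂ψ = rhoHat ψ 0 from rfl]
    simp
  | succ m =>
    have hinner : ∀ k : ℕ, k < m → moment ψ (WHat ψ (m + 2)) (2 * k + 1 - m) = 0 := by
      intro k hk
      obtain ⟨n, rfl⟩ : ∃ n, m = n + 1 := ⟨m - 1, by omega⟩
      rw [moment_WHat_succ hsupp,
        show (2 * (k : ℤ) + 1 - ((n + 1 : ℕ) : ℤ) + 1) = 2 * ((k + 1 : ℕ) : ℤ) - ((n + 1 : ℕ) : ℤ)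
          by push_cast; ring,
        show (2 * (k : ℤ) + 1 - ((n + 1 : ℕ) : ℤ) - 1) = 2 * (k : ℤ) - ((n + 1 : ℕ) : ℤ)
          by push_cast; ring,
        show (2 * (k : ℤ) + 1 - ((n + 1 : ℕ) : ℤ)) = 2 * (k : ℤ) - (n : ℤ) by push_cast; ring,
        ih (n + 1) (by omega) (k + 1) (by omega), ih (n + 1) (by omega) k (by omega),
        show n + 2 - 1 = n + 1 from rfl, ih n (by omega) k (by omega)]
      simp
    have hext := moment_WHat_extreme hsupp hinf m (ih m (by omega)) hinner
    intro k hk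
    rcases Nat.lt_or_ge m k with h | h
    · obtain rfl : k = m + 1 := by omega
      rw [← hext]
      congr 1
      push_cast
      ring
    rcases Nat.eq_zero_or_pos k with rfl | h0
    · rw [show (2 * ((0 : ℕ) : ℤ) - ((m + 1 : ℕ) : ℤ)) = -(m + 1 : ℤ) by push_cast; ring,
        ← conj_moment hsupp, hext, map_zero]
    · rw [← hinner (k - 1) (by omega)]
      congr 1
      push_cast [Nat.cast_sub h0]
      ring

/-- `Ŵ_{m+1}` is orthogonal in `L²(ψ)` to the balanced functions of order `m`. -/
lemma IsBalanced.integral_mul_WHat {ψ : Measure ℝ} [IsFiniteMeasure ψ]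
    (hsupp : ψ (Set.Icc (-1) 1)ᶜ = 0) (hinf : ∀ s : Set ℝ, s.Finite → ψ sᶜ ≠ 0) {m : ℕ} {f : ℝ → ℝ}
    (hf : IsBalanced m fun x => (f x : ℂ)) : ∫ x, f x * WHat ψ (m + 1) x ∂ψ = 0 :=
  hf.integral_ofReal_mul_eq_zero hsupp (continuous_WHat ψ _) (moment_WHat_eq_zero hsupp hinf m)

/-- Both `∫ x √(1-x²) Ŵ_m Ŵ_{m+1} dψ` and `∫ (1-x²) Ŵ_m Ŵ_{m+1} dψ` are determined by the `β̂` and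
`ρ̂_{m+1}` through two linear equations, which come from expanding one factor in
`∫ √(1-x²) Ŵ_{m+1}² dψ` and `∫ x Ŵ_{m+1}² dψ` by the recurrence. -/
theorem alphaHat_mul_eq {ψ : Measure ℝ} [IsFiniteMeasure ψ]
    (hsupp : ψ (Set.Icc (-1) 1)ᶜ = 0) (hinf : ∀ s : Set ℝ, s.Finite → ψ sᶜ ≠ 0) (m : ℕ) :
    alphaHat ψ (m + 2) * (rhoHat ψ m * (1 + betaHat ψ (m + 1) ^ 2)) =
      rhoHat ψ (m + 1) * (1 + betaHat ψ (m + 2) ^ 2) := by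
  have c0 := continuous_WHat ψ m
  have c1 := continuous_WHat ψ (m + 1)
  have cp := continuous_WHat ψ (m - 1)
  have h01 := (isBalanced_WHat ψ m).integral_mul_WHat hsupp hinf
  have hps : alphaHat ψ (m + 1) * ∫ x, √(1 - x ^ 2) * WHat ψ (m - 1) x * WHat ψ (m + 1) x ∂ψ
      = 0 := by
    cases m with
    | zero => simp [alphaHat]
    | succ n =>
      rw [IsBalanced.integral_mul_WHat hsupp hinf, mul_zero]
      simpa using (isBalanced_WHat ψ n).sqrt_mul
  have hpx : alphaHat ψ (m + 1) * ∫ x, x * WHat ψ (m - 1) x * WHat ψ (m + 1) x ∂ψ = 0 := by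
    cases m with
    | zero => simp [alphaHat]
    | succ n =>
      rw [IsBalanced.integral_mul_WHat hsupp hinf, mul_zero]
      simpa using (isBalanced_WHat ψ n).ofReal_mul
  set A := ∫ x, x * √(1 - x ^ 2) * (WHat ψ m x * WHat ψ (m + 1) x) ∂ψ with hA
  set B := ∫ x, √(1 - x ^ 2) ^ 2 * (WHat ψ m x * WHat ψ (m + 1) x) ∂ψ with hB
  have e1 : rhoHat ψ (m + 1) = A - betaHat ψ (m + 1) * B := by
    have h : ∀ x, WHat ψ (m + 1) x ^ 2 * √(1 - x ^ 2) =
        x * √(1 - x ^ 2) * (WHat ψ m x * WHat ψ (m + 1) x) -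
        betaHat ψ (m + 1) * (√(1 - x ^ 2) ^ 2 * (WHat ψ m x * WHat ψ (m + 1) x)) -
        alphaHat ψ (m + 1) * (√(1 - x ^ 2) * WHat ψ (m - 1) x * WHat ψ (m + 1) x) := fun x => by
      linear_combination √(1 - x ^ 2) * WHat ψ (m + 1) x * WHat_succ ψ m x
    simp only [rhoHat, h]
    rw [integral_sub (integrable_of_continuous hsupp (by fun_prop))
      (integrable_of_continuous hsupp (by fun_prop)),
      integral_sub (integrable_of_continuous hsupp (by fun_prop))
      (integrable_of_continuous hsupp (by fun_prop)), integral_const_mul, integral_const_mul, hps,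
      sub_zero]
  have e2 : betaHat ψ (m + 2) * rhoHat ψ (m + 1) = -B - betaHat ψ (m + 1) * A := by
    rw [← integral_mul_WHat_sq hsupp hinf]
    have h : (fun x => x * WHat ψ (m + 1) x ^ 2) =ᵐ[ψ] fun x =>
        WHat ψ m x * WHat ψ (m + 1) x - √(1 - x ^ 2) ^ 2 * (WHat ψ m x * WHat ψ (m + 1) x) -
        betaHat ψ (m + 1) * (x * √(1 - x ^ 2) * (WHat ψ m x * WHat ψ (m + 1) x)) -
        alphaHat ψ (m + 1) * (x * WHat ψ (m - 1) x * WHat ψ (m + 1) x) := by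
      filter_upwards [ae_mem_Icc hsupp] with x hx
      linear_combination x * WHat ψ (m + 1) x * WHat_succ ψ m x +
        WHat ψ m x * WHat ψ (m + 1) x * sq_sqrt_one_sub hx
    rw [integral_congr_ae h, integral_sub (integrable_of_continuous hsupp (by fun_prop))
      (integrable_of_continuous hsupp (by fun_prop)),
      integral_sub (integrable_of_continuous hsupp (by fun_prop))
      (integrable_of_continuous hsupp (by fun_prop)),
      integral_sub (integrable_of_continuous hsupp (by fun_prop))
      (integrable_of_continuous hsupp (by fun_prop)), integral_const_mul, integral_const_mul, hpx,
      h01]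
    ring
  have e3 : alphaHat ψ (m + 2) * rhoHat ψ m = A - betaHat ψ (m + 2) * B := by
    have h : ∀ x, (x - betaHat ψ (m + 2) * √(1 - x ^ 2)) * WHat ψ m x * WHat ψ (m + 1) x *
        √(1 - x ^ 2) = x * √(1 - x ^ 2) * (WHat ψ m x * WHat ψ (m + 1) x) -
        betaHat ψ (m + 2) * (√(1 - x ^ 2) ^ 2 * (WHat ψ m x * WHat ψ (m + 1) x)) := fun x => by
      ring
    simp only [alphaHat, h]
    rw [integral_sub (integrable_of_continuous hsupp (by fun_prop))
      (integrable_of_continuous hsupp (by fun_prop)), integral_const_mul, ← hA, ← hB]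
    have := (rhoHat_pos hsupp hinf m).ne'
    field_simp
  linear_combination (1 + betaHat ψ (m + 1) ^ 2) * e3 -
    (1 + betaHat ψ (m + 1) * betaHat ψ (m + 2)) * e1 -
    (betaHat ψ (m + 2) - betaHat ψ (m + 1)) * e2

lemma alphaHat_pos {ψ : Measure ℝ} [IsFiniteMeasure ψ] (hsupp : ψ (Set.Icc (-1) 1)ᶜ = 0)
    (hinf : ∀ s : Set ℝ, s.Finite → ψ sᶜ ≠ 0) (m : ℕ) : 0 < alphaHat ψ (m + 2) := by
  have h := alphaHat_mul_eq hsupp hinf m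
  have h0 := rhoHat_pos hsupp hinf m
  have h1 := rhoHat_pos hsupp hinf (m + 1)
  have h2 : 0 < alphaHat ψ (m + 2) * (rhoHat ψ m * (1 + betaHat ψ (m + 1) ^ 2)) := by
    rw [h]; positivity
  exact pos_of_mul_pos_left h2 (by positivity)

/-! ### The measure on `[-1, 1]` below a circle measure -/

/-- `ν` is a probability measure on `[-1, 1]` with `√(1-x²) dν = c dψ`; it may charge `±1`. -/
structure IsLineMeasure (ψ ν : Measure ℝ) (c : ℝ) : Prop where
  isProbabilityMeasure : IsProbabilityMeasure ν
  support : ν (Set.Icc (-1) 1)ᶜ = 0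
  pos : 0 < c
  withDensity_eq : ν.withDensity (fun x => ENNReal.ofReal √(1 - x ^ 2)) = ENNReal.ofReal c • ψ

namespace IsLineMeasure

variable {ψ ν : Measure ℝ} {c : ℝ}

lemma absolutelyContinuous (h : IsLineMeasure ψ ν c) : ψ ≪ ν := by
  have h1 : ψ ≪ ENNReal.ofReal c • ψ :=
    Measure.absolutelyContinuous_smul (ENNReal.ofReal_pos.2 h.pos).ne'
  rw [← h.withDensity_eq] at h1
  exact h1.trans (withDensity_absolutelyContinuous _ _)

lemma integral_sqrt_smul {E : Type*} [NormedAddCommGroup E] [NormedSpace ℝ E]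
    (h : IsLineMeasure ψ ν c) (F : ℝ → E) :
    ∫ x, √(1 - x ^ 2) • F x ∂ν = c • ∫ x, F x ∂ψ := by
  have h1 := integral_withDensity_eq_integral_toReal_smul (μ := ν)
    (f := fun x => ENNReal.ofReal √(1 - x ^ 2)) (by fun_prop)
    (Filter.Eventually.of_forall fun x => ENNReal.ofReal_lt_top) F
  rw [h.withDensity_eq, integral_smul_measure, ENNReal.toReal_ofReal h.pos.le] at h1
  rw [h1]
  simp only [ENNReal.toReal_ofReal (Real.sqrt_nonneg _)]

lemma integral_sqrt_mul (h : IsLineMeasure ψ ν c) (F : ℝ → ℝ) :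
    ∫ x, √(1 - x ^ 2) * F x ∂ν = c * ∫ x, F x ∂ψ := h.integral_sqrt_smul F

/-- Neighbouring moments against `ν` differ by a moment against `ψ`, because
`e^{i(j+2)θ/2} - e^{ijθ/2} = 2i √(1-x²) e^{i(j+1)θ/2}`. -/
lemma moment_add_two (h : IsLineMeasure ψ ν c) {F : ℝ → ℝ} (hF : Continuous F) (j : ℤ) :
    moment ν F (j + 2) = moment ν F j + 2 * Complex.I * c * moment ψ F (j + 1) := by
  have := h.isProbabilityMeasure
  have h1 := h.integral_sqrt_smul fun x => halfPoint x ^ (j + 1) * (F x : ℂ)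
  rw [Complex.real_smul] at h1
  have h2 : moment ν F (j + 2) - moment ν F j = 2 * Complex.I * (c * moment ψ F (j + 1)) := by
    rw [moment, moment, moment, ← h1, ← integral_const_mul,
      ← integral_sub (integrable_moment h.support hF _) (integrable_moment h.support hF _)]
    refine integral_congr_ae ?_
    filter_upwards [ae_mem_Icc h.support] with x hx
    have hx0 := halfPoint_ne_zero x
    rw [Complex.real_smul, zpow_add₀ hx0, zpow_add_one₀ hx0, zpow_ofNat]
    linear_combination (-2 * Complex.I * halfPoint x ^ j * F x) * sqrt_mul_halfPoint hx +
      halfPoint x ^ j * F x * (halfPoint x ^ 2 - 1) * Complex.I_sq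
  linear_combination h2

end IsLineMeasure

/-- `e_m = ∫ x^m Ŵ_m dν`, which is also the value of every moment of `Ŵ_m` of index
`-m, -m+2, …, m` against `ν`. -/
def kernelMean (ψ ν : Measure ℝ) (m : ℕ) : ℝ := ∫ x, x ^ m * WHat ψ m x ∂ν

lemma kernelMean_zero {ψ ν : Measure ℝ} {c : ℝ} (h : IsLineMeasure ψ ν c) :
    kernelMean ψ ν 0 = 1 := by
  have := h.isProbabilityMeasure
  simp [kernelMean, WHat]

section

variable {ψ ν : Measure ℝ} {c : ℝ} [IsFiniteMeasure ψ]

theorem moment_WHat_eq_kernelMean (h : IsLineMeasure ψ ν c) (hsupp : ψ (Set.Icc (-1) 1)ᶜ = 0)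
    (hinf : ∀ s : Set ℝ, s.Finite → ψ sᶜ ≠ 0) (m : ℕ) :
    ∀ k : ℕ, k ≤ m → moment ν (WHat ψ m) (2 * k - m) = kernelMean ψ ν m := by
  have := h.isProbabilityMeasure
  have hW := continuous_WHat ψ m
  have hconst : ∀ k : ℕ, k ≤ m → moment ν (WHat ψ m) (2 * k - m) = moment ν (WHat ψ m) (-m) := by
    intro k
    induction k with
    | zero => simp
    | succ k ih =>
      intro hk
      obtain ⟨n, rfl⟩ : ∃ n, m = n + 1 := ⟨m - 1, by omega⟩
      rw [show (2 * ((k + 1 : ℕ) : ℤ) - ((n + 1 : ℕ) : ℤ)) = 2 * k - ((n + 1 : ℕ) : ℤ) + 2 by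
        push_cast; ring, h.moment_add_two hW, ih (by omega),
        show (2 * (k : ℤ) - ((n + 1 : ℕ) : ℤ) + 1) = 2 * k - n by push_cast; ring,
        moment_WHat_eq_zero hsupp hinf n k (by omega), mul_zero, add_zero]
  have h1 := (isBalanced_pow m).integral_mul h.support hW hconst
  have h2 : (kernelMean ψ ν m : ℂ) = moment ν (WHat ψ m) (-m) := by
    rw [Complex.ofReal_one, one_pow, one_mul] at h1
    rw [← h1, kernelMean, ← integral_complex_ofReal]
    simp
  intro k hk
  rw [hconst k hk, h2]

/-- Integration against `Ŵ_m dν` is `e_m` times evaluation at `x = 1` on balanced functions of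
order `m`: up to a factor, `Ŵ_m` is the reproducing kernel at `z = 1`. -/
lemma IsBalanced.integral_mul_WHat_line {m : ℕ} {f : ℝ → ℝ}
    (hf : IsBalanced m fun x => (f x : ℂ)) (h : IsLineMeasure ψ ν c)
    (hsupp : ψ (Set.Icc (-1) 1)ᶜ = 0) (hinf : ∀ s : Set ℝ, s.Finite → ψ sᶜ ≠ 0) :
    ∫ x, f x * WHat ψ m x ∂ν = f 1 * kernelMean ψ ν m := by
  have := h.isProbabilityMeasure
  have h1 := hf.integral_mul h.support (continuous_WHat ψ m)
    (moment_WHat_eq_kernelMean h hsupp hinf m)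
  simp only [← Complex.ofReal_mul, integral_complex_ofReal] at h1
  exact_mod_cast h1

lemma kernelMean_one (h : IsLineMeasure ψ ν c) (hsupp : ψ (Set.Icc (-1) 1)ᶜ = 0)
    (hinf : ∀ s : Set ℝ, s.Finite → ψ sᶜ ≠ 0) :
    kernelMean ψ ν 1 = 1 - c * (rhoHat ψ 0 * (1 + betaHat ψ 1 ^ 2)) := by
  have := h.isProbabilityMeasure
  have h1 := h.integral_sqrt_mul fun x => √(1 - x ^ 2)
  have h2 := h.integral_sqrt_mul fun x => x
  have h3 : ∫ x, x ∂ψ = betaHat ψ 1 * rhoHat ψ 0 := by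
    simpa [WHat] using integral_mul_WHat_sq hsupp hinf 0
  have h4 : ∫ x, √(1 - x ^ 2) ∂ψ = rhoHat ψ 0 := by simp [rhoHat, WHat]
  have h5 : (fun x => x ^ 1 * WHat ψ 1 x) =ᵐ[ν] fun x =>
      1 - √(1 - x ^ 2) * √(1 - x ^ 2) - betaHat ψ 1 * (√(1 - x ^ 2) * x) := by
    filter_upwards [ae_mem_Icc h.support] with x hx
    rw [WHat_one]
    linear_combination sq_sqrt_one_sub hx
  rw [kernelMean, integral_congr_ae h5,
    integral_sub (integrable_of_continuous h.support (by fun_prop))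
      (integrable_of_continuous h.support (by fun_prop)),
    integral_sub (integrable_of_continuous h.support (by fun_prop))
      (integrable_of_continuous h.support (by fun_prop)), integral_const_mul, h1, h2, h3, h4]
  simp
  ring

lemma kernelMean_add_two (h : IsLineMeasure ψ ν c) (hsupp : ψ (Set.Icc (-1) 1)ᶜ = 0)
    (hinf : ∀ s : Set ℝ, s.Finite → ψ sᶜ ≠ 0) (m : ℕ) :
    kernelMean ψ ν (m + 2) = kernelMean ψ ν (m + 1) - alphaHat ψ (m + 2) * kernelMean ψ ν m := by
  have := h.isProbabilityMeasure
  have c0 := continuous_WHat ψ m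
  have c1 := continuous_WHat ψ (m + 1)
  have hpow : ∀ n : ℕ, IsBalanced n fun x => ((x ^ n : ℝ) : ℂ) := fun n => by
    simpa using isBalanced_pow n
  -- `x ^ m` takes the value `1` at `1`, so it may replace `x ^ (m + 2)` in `e_{m+2}`.
  have h2 := (hpow m).add_two.integral_mul_WHat_line h hsupp hinf
  have horth := (hpow m).integral_mul_WHat hsupp hinf
  have hs := h.integral_sqrt_mul fun x => x ^ m * WHat ψ (m + 1) x
  rw [horth, mul_zero] at hs
  have hx : ∀ x, x ^ m * WHat ψ (m + 2) x = x ^ (m + 1) * WHat ψ (m + 1) x -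
      betaHat ψ (m + 2) * (√(1 - x ^ 2) * (x ^ m * WHat ψ (m + 1) x)) -
      alphaHat ψ (m + 2) * (x ^ m * WHat ψ m x) := fun x => by
    rw [WHat_add_two]; ring
  simp only [hx, one_pow, one_mul] at h2
  rw [← h2, integral_sub (integrable_of_continuous h.support (by fun_prop))
      (integrable_of_continuous h.support (by fun_prop)),
    integral_sub (integrable_of_continuous h.support (by fun_prop))
      (integrable_of_continuous h.support (by fun_prop)), integral_const_mul, integral_const_mul,
    hs, mul_zero, sub_zero]
  rfl

lemma WHat_add_two_at_one (ψ : Measure ℝ) (m : ℕ) :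
    WHat ψ (m + 2) 1 = WHat ψ (m + 1) 1 - alphaHat ψ (m + 2) * WHat ψ m 1 := by
  simp [WHat_add_two]

lemma integral_WHat_sq (h : IsLineMeasure ψ ν c) (hsupp : ψ (Set.Icc (-1) 1)ᶜ = 0)
    (hinf : ∀ s : Set ℝ, s.Finite → ψ sᶜ ≠ 0) (m : ℕ) :
    ∫ x, WHat ψ m x ^ 2 ∂ν = WHat ψ m 1 * kernelMean ψ ν m := by
  simp only [sq]
  exact (isBalanced_WHat ψ m).integral_mul_WHat_line h hsupp hinf

lemma WHat_one_mul_kernelMean_pos (h : IsLineMeasure ψ ν c) (hsupp : ψ (Set.Icc (-1) 1)ᶜ = 0)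
    (hinf : ∀ s : Set ℝ, s.Finite → ψ sᶜ ≠ 0) (m : ℕ) :
    0 < WHat ψ m 1 * kernelMean ψ ν m := by
  have := h.isProbabilityMeasure
  have hW := continuous_WHat ψ m
  rw [← integral_WHat_sq h hsupp hinf]
  refine integral_pos_of_finite_zeros hsupp hinf h.support h.absolutelyContinuous (by fun_prop)
    (fun x => sq_nonneg _) ((finite_zeros_WHat ψ m).subset fun x hx => ⟨hx.1, ?_⟩)
  exact pow_eq_zero_iff two_ne_zero |>.1 hx.2

lemma kernelMean_ne_zero (h : IsLineMeasure ψ ν c) (hsupp : ψ (Set.Icc (-1) 1)ᶜ = 0)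
    (hinf : ∀ s : Set ℝ, s.Finite → ψ sᶜ ≠ 0) (m : ℕ) : kernelMean ψ ν m ≠ 0 :=
  right_ne_zero_of_mul (WHat_one_mul_kernelMean_pos h hsupp hinf m).ne'

/-- The Casorati determinant of the two solutions `Ŵ_m(1)` and `e_m` of
`y_{m+2} = y_{m+1} - α̂_{m+2} y_m`. -/
lemma casorati_pos (h : IsLineMeasure ψ ν c) (hsupp : ψ (Set.Icc (-1) 1)ᶜ = 0)
    (hinf : ∀ s : Set ℝ, s.Finite → ψ sᶜ ≠ 0) (m : ℕ) :
    0 < WHat ψ (m + 1) 1 * kernelMean ψ ν m - WHat ψ m 1 * kernelMean ψ ν (m + 1) := by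
  induction m with
  | zero =>
    have h0 := rhoHat_pos hsupp hinf 0
    have h1 := h.pos
    rw [zero_add, WHat_one, kernelMean_zero h, kernelMean_one h hsupp hinf]
    have : 0 < c * (rhoHat ψ 0 * (1 + betaHat ψ 1 ^ 2)) := by positivity
    simpa [WHat] using this
  | succ m ih =>
    have := mul_pos (alphaHat_pos hsupp hinf m) ih
    rw [WHat_add_two_at_one, kernelMean_add_two h hsupp hinf]
    linarith

/-- With `γ = e_{m+1} / e_m`, the function `e^{iθ/2} Ŵ_{m+1} - γ Ŵ_m` has squared `L²(ν)` norm
`γ` times the Casorati determinant, so `γ` is positive. -/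
lemma kernelMean_div_pos (h : IsLineMeasure ψ ν c) (hsupp : ψ (Set.Icc (-1) 1)ᶜ = 0)
    (hinf : ∀ s : Set ℝ, s.Finite → ψ sᶜ ≠ 0) (m : ℕ) :
    0 < kernelMean ψ ν (m + 1) / kernelMean ψ ν m := by
  have := h.isProbabilityMeasure
  have c0 := continuous_WHat ψ m
  have c1 := continuous_WHat ψ (m + 1)
  have he := kernelMean_ne_zero h hsupp hinf m
  set γ := kernelMean ψ ν (m + 1) / kernelMean ψ ν m with hγ
  have hγ0 : γ ≠ 0 := div_ne_zero (kernelMean_ne_zero h hsupp hinf (m + 1)) he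
  have hγe : γ * kernelMean ψ ν m = kernelMean ψ ν (m + 1) := div_mul_cancel₀ _ he
  have hcross : ∫ x, x * WHat ψ m x * WHat ψ (m + 1) x ∂ν =
      WHat ψ m 1 * kernelMean ψ ν (m + 1) := by
    rw [IsBalanced.integral_mul_WHat_line (f := fun x => x * WHat ψ m x) _ h hsupp hinf, one_mul]
    simpa using (isBalanced_WHat ψ m).ofReal_mul
  have hpos : 0 < ∫ x, ((WHat ψ (m + 1) x - γ * (x * WHat ψ m x)) ^ 2 +
      (γ * (WHat ψ m x * √(1 - x ^ 2))) ^ 2) ∂ν := by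
    refine integral_pos_of_finite_zeros hsupp hinf h.support h.absolutelyContinuous (by fun_prop)
      (fun x => by positivity) ((finite_zeros_WHat_mul_sqrt ψ m).subset fun x hx => ⟨hx.1, ?_⟩)
    have h2 : (γ * (WHat ψ m x * √(1 - x ^ 2))) ^ 2 = 0 :=
      le_antisymm (by nlinarith [hx.2, sq_nonneg (WHat ψ (m + 1) x - γ * (x * WHat ψ m x))])
        (sq_nonneg _)
    exact (mul_eq_zero.1 (pow_eq_zero_iff two_ne_zero |>.1 h2)).resolve_left hγ0
  have hexp : (fun x => (WHat ψ (m + 1) x - γ * (x * WHat ψ m x)) ^ 2 +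
      (γ * (WHat ψ m x * √(1 - x ^ 2))) ^ 2) =ᵐ[ν] fun x =>
      WHat ψ (m + 1) x ^ 2 - 2 * γ * (x * WHat ψ m x * WHat ψ (m + 1) x) +
        γ ^ 2 * WHat ψ m x ^ 2 := by
    filter_upwards [ae_mem_Icc h.support] with x hx
    linear_combination γ ^ 2 * WHat ψ m x ^ 2 * sq_sqrt_one_sub hx
  rw [integral_congr_ae hexp, integral_add (integrable_of_continuous h.support (by fun_prop))
      (integrable_of_continuous h.support (by fun_prop)),
    integral_sub (integrable_of_continuous h.support (by fun_prop))
      (integrable_of_continuous h.support (by fun_prop)), integral_const_mul, integral_const_mul,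
    hcross, integral_WHat_sq h hsupp hinf, integral_WHat_sq h hsupp hinf] at hpos
  refine pos_of_mul_pos_left (b := WHat ψ (m + 1) 1 * kernelMean ψ ν m -
    WHat ψ m 1 * kernelMean ψ ν (m + 1)) ?_ (casorati_pos h hsupp hinf m).le
  rw [← hγe] at hpos ⊢
  linarith

lemma kernelMean_pos (h : IsLineMeasure ψ ν c) (hsupp : ψ (Set.Icc (-1) 1)ᶜ = 0)
    (hinf : ∀ s : Set ℝ, s.Finite → ψ sᶜ ≠ 0) (m : ℕ) : 0 < kernelMean ψ ν m := by
  induction m with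
  | zero => rw [kernelMean_zero h]; exact one_pos
  | succ m ih => exact (div_pos_iff_of_pos_right ih).1 (kernelMean_div_pos h hsupp hinf m)

lemma WHat_one_pos (h : IsLineMeasure ψ ν c) (hsupp : ψ (Set.Icc (-1) 1)ᶜ = 0)
    (hinf : ∀ s : Set ℝ, s.Finite → ψ sᶜ ≠ 0) (m : ℕ) : 0 < WHat ψ m 1 :=
  pos_of_mul_pos_left (WHat_one_mul_kernelMean_pos h hsupp hinf m)
    (kernelMean_pos h hsupp hinf m).le

/-! ### The parameter sequences -/

/-- `g_m = 1 - e_m / e_{m-1}` for `m ≥ 1`, and `g_0 = 0`. -/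
def chainParam (ψ ν : Measure ℝ) : ℕ → ℝ
  | 0 => 0
  | m + 1 => 1 - kernelMean ψ ν (m + 1) / kernelMean ψ ν m

lemma chainParam_one (h : IsLineMeasure ψ ν c) (hsupp : ψ (Set.Icc (-1) 1)ᶜ = 0)
    (hinf : ∀ s : Set ℝ, s.Finite → ψ sᶜ ≠ 0) :
    chainParam ψ ν 1 = c * (rhoHat ψ 0 * (1 + betaHat ψ 1 ^ 2)) := by
  rw [chainParam, kernelMean_zero h, kernelMean_one h hsupp hinf]
  ring

lemma alphaHat_eq_chainParam (h : IsLineMeasure ψ ν c) (hsupp : ψ (Set.Icc (-1) 1)ᶜ = 0)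
    (hinf : ∀ s : Set ℝ, s.Finite → ψ sᶜ ≠ 0) (m : ℕ) :
    alphaHat ψ (m + 2) = (1 - chainParam ψ ν (m + 1)) * chainParam ψ ν (m + 2) := by
  have h0 := kernelMean_ne_zero h hsupp hinf m
  have h1 := kernelMean_ne_zero h hsupp hinf (m + 1)
  rw [chainParam, chainParam, kernelMean_add_two h hsupp hinf]
  field_simp
  ring

lemma chainParam_lt_one (h : IsLineMeasure ψ ν c) (hsupp : ψ (Set.Icc (-1) 1)ᶜ = 0)
    (hinf : ∀ s : Set ℝ, s.Finite → ψ sᶜ ≠ 0) (m : ℕ) : chainParam ψ ν (m + 1) < 1 :=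
  sub_lt_self 1 (kernelMean_div_pos h hsupp hinf m)

lemma chainParam_pos (h : IsLineMeasure ψ ν c) (hsupp : ψ (Set.Icc (-1) 1)ᶜ = 0)
    (hinf : ∀ s : Set ℝ, s.Finite → ψ sᶜ ≠ 0) (m : ℕ) : 0 < chainParam ψ ν (m + 1) := by
  cases m with
  | zero =>
    have h0 := rhoHat_pos hsupp hinf 0
    have h1 := h.pos
    rw [chainParam_one h hsupp hinf]
    positivity
  | succ m =>
    have h1 := alphaHat_pos hsupp hinf m
    rw [alphaHat_eq_chainParam h hsupp hinf] at h1
    exact pos_of_mul_pos_right h1 (sub_pos.2 (chainParam_lt_one h hsupp hinf m)).le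

lemma isParameterSequence_chainParam (h : IsLineMeasure ψ ν c) (hsupp : ψ (Set.Icc (-1) 1)ᶜ = 0)
    (hinf : ∀ s : Set ℝ, s.Finite → ψ sᶜ ≠ 0) :
    IsParameterSequence (fun n => alphaHat ψ (n + 1)) (fun n => chainParam ψ ν (n + 1)) where
  zero_nonneg := (chainParam_pos h hsupp hinf 0).le
  zero_lt_one := chainParam_lt_one h hsupp hinf 0
  pos n _ := chainParam_pos h hsupp hinf n
  lt_one n _ := chainParam_lt_one h hsupp hinf n
  eq n := alphaHat_eq_chainParam h hsupp hinf n

/-- Two parameter sequences of one chain sequence are ordered as their initial values. -/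
lemma parameterSequence_le_of_zero_le {a g M : ℕ → ℝ} (hg : IsParameterSequence a g)
    (hM : IsParameterSequence a M) (h0 : g 0 ≤ M 0) (n : ℕ) : g n ≤ M n := by
  induction n with
  | zero => exact h0
  | succ n ih =>
    have hMn : M n < 1 := by
      rcases n.eq_zero_or_pos with rfl | hn
      exacts [hM.zero_lt_one, hM.lt_one n hn]
    have h1 := hg.eq n
    have h2 := hM.eq n
    have h3 := hg.pos (n + 1) (by omega)
    nlinarith

/-- The extremal property of the kernel, tested on `x^m`. -/
lemma kernelMean_le (h : IsLineMeasure ψ ν c) (hsupp : ψ (Set.Icc (-1) 1)ᶜ = 0)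
    (hinf : ∀ s : Set ℝ, s.Finite → ψ sᶜ ≠ 0) (m : ℕ) :
    kernelMean ψ ν m ≤ WHat ψ m 1 * ∫ x, (x ^ m) ^ 2 ∂ν := by
  have := h.isProbabilityMeasure
  have hW := continuous_WHat ψ m
  have hW1 := WHat_one_pos h hsupp hinf m
  have h0 : 0 ≤ ∫ x, (WHat ψ m 1 * x ^ m - WHat ψ m x) ^ 2 ∂ν :=
    integral_nonneg fun x => sq_nonneg _
  have hexp : ∀ x, (WHat ψ m 1 * x ^ m - WHat ψ m x) ^ 2 = WHat ψ m 1 ^ 2 * (x ^ m) ^ 2 -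
      2 * WHat ψ m 1 * (x ^ m * WHat ψ m x) + WHat ψ m x ^ 2 := fun x => by ring
  simp only [hexp] at h0
  rw [integral_add (integrable_of_continuous h.support (by fun_prop))
      (integrable_of_continuous h.support (by fun_prop)),
    integral_sub (integrable_of_continuous h.support (by fun_prop))
      (integrable_of_continuous h.support (by fun_prop)), integral_const_mul, integral_const_mul,
    integral_WHat_sq h hsupp hinf, ← kernelMean] at h0
  refine le_of_mul_le_mul_left ?_ hW1
  linarith

lemma tendsto_integral_pow_sq [IsFiniteMeasure ν] (hν : ∀ᵐ x ∂ν, x ∈ Set.Ioo (-1 : ℝ) 1) :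
    Filter.Tendsto (fun m : ℕ => ∫ x, (x ^ m) ^ 2 ∂ν) Filter.atTop (nhds 0) := by
  have h := tendsto_integral_of_dominated_convergence (μ := ν)
    (F := fun (m : ℕ) x => (x ^ m) ^ 2) (f := fun _ => 0) (fun _ => (1 : ℝ))
    (fun m => by fun_prop) (integrable_const 1)
    (fun m => by
      filter_upwards [hν] with x hx
      rw [norm_pow, norm_pow]
      exact pow_le_one₀ (by positivity) (pow_le_one₀ (norm_nonneg x) (abs_lt.2 hx).le))
    (by
      filter_upwards [hν] with x hx
      have := (tendsto_pow_atTop_nhds_zero_of_abs_lt_one (abs_lt.2 hx)).pow 2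
      simpa using this)
  simpa using h

/-- When `ν` does not charge `±1`, its parameter sequence is maximal. For a second parameter
sequence `g`, the products `∏ (1 - g_i)` solve the recurrence of `e_m` and `Ŵ_m(1)`. If `g_0` were
larger, the coefficient of `Ŵ_m(1)` in them would be negative, while `Ŵ_m(1) / e_m → ∞`. -/
theorem isMaximalParameterSequence_chainParam (h : IsLineMeasure ψ ν c)
    (hsupp : ψ (Set.Icc (-1) 1)ᶜ = 0) (hinf : ∀ s : Set ℝ, s.Finite → ψ sᶜ ≠ 0)
    (hν : ∀ᵐ x ∂ν, x ∈ Set.Ioo (-1 : ℝ) 1) :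
    IsMaximalParameterSequence (fun n => alphaHat ψ (n + 1)) (fun n => chainParam ψ ν (n + 1)) := by
  have := h.isProbabilityMeasure
  have hM := isParameterSequence_chainParam h hsupp hinf
  refine ⟨hM, fun g hg n => parameterSequence_le_of_zero_le hg hM ?_ n⟩
  by_contra! hlt
  simp only [zero_add] at hlt
  set M := chainParam ψ ν 1 with hMdef
  have hM1 : kernelMean ψ ν 1 = 1 - M := by
    rw [hMdef, chainParam, kernelMean_zero h]; ring
  have hM0 : 0 < M := chainParam_pos h hsupp hinf 0
  let B : ℕ → ℝ := fun n => ∏ i ∈ Finset.range n, (1 - g i)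
  have hB : ∀ n, 0 < B n := fun n => Finset.prod_pos fun i _ => by
    rcases i.eq_zero_or_pos with rfl | hi
    exacts [sub_pos.2 hg.zero_lt_one, sub_pos.2 (hg.lt_one i hi)]
  have hsol : ∀ n, M * B n = g 0 * kernelMean ψ ν n - (g 0 - M) * WHat ψ n 1 := by
    intro n
    induction n using Nat.twoStepInduction with
    | zero => simp [B, kernelMean_zero h, WHat]
    | one => simp [B, hM1, WHat_one]; ring
    | more n h0 h1 =>
      have hrec : B (n + 2) = B (n + 1) - alphaHat ψ (n + 2) * B n := by
        simp only [B, Finset.prod_range_succ]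
        linear_combination (∏ i ∈ Finset.range n, (1 - g i)) * hg.eq n
      rw [hrec, kernelMean_add_two h hsupp hinf, WHat_add_two_at_one]
      linear_combination h1 - alphaHat ψ (n + 2) * h0
  have hlim := (tendsto_integral_pow_sq hν).const_mul (g 0)
  rw [mul_zero] at hlim
  obtain ⟨n, hn⟩ := (hlim.eventually_lt_const (sub_pos.2 hlt)).exists
  have h1 := mul_pos hM0 (hB n)
  rw [hsol] at h1
  have h2 := mul_le_mul_of_nonneg_left (kernelMean_le h hsupp hinf n) hg.zero_nonneg
  have h3 := mul_lt_mul_of_pos_right hn (WHat_one_pos h hsupp hinf n)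
  linarith

end

/-! ### From the circle to the line -/

lemma isFiniteMeasure_of_lintegral_inv_lt_top {ψ : Measure ℝ}
    (hint : ∫⁻ x, (ENNReal.ofReal √(1 - x ^ 2))⁻¹ ∂ψ < ⊤) : IsFiniteMeasure ψ := by
  refine ⟨lt_of_le_of_lt ?_ hint⟩
  rw [← lintegral_one]
  refine lintegral_mono fun x => ENNReal.one_le_inv.2 ?_
  rw [ENNReal.ofReal_le_one]
  exact Real.sqrt_le_one.2 (by nlinarith [sq_nonneg x])

lemma ae_mem_Ioo {ψ : Measure ℝ} (hint : ∫⁻ x, (ENNReal.ofReal √(1 - x ^ 2))⁻¹ ∂ψ < ⊤) :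
    ∀ᵐ x ∂ψ, x ∈ Set.Ioo (-1 : ℝ) 1 := by
  filter_upwards [ae_lt_top (by fun_prop) hint.ne] with x hx
  rw [ENNReal.inv_lt_top, ENNReal.ofReal_pos, Real.sqrt_pos] at hx
  exact abs_lt.1 ((sq_lt_one_iff_abs_lt_one x).1 (by linarith))

/-- `t δ_1 + c (1-x²)^{-1/2} dψ`. -/
def lineMeasure (ψ : Measure ℝ) (t c : ℝ) : Measure ℝ :=
  ENNReal.ofReal t • Measure.dirac 1 +
    ENNReal.ofReal c • ψ.withDensity fun x => (ENNReal.ofReal √(1 - x ^ 2))⁻¹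

lemma lineMeasure_univ (ψ : Measure ℝ) (t c : ℝ) : lineMeasure ψ t c Set.univ =
    ENNReal.ofReal t + ENNReal.ofReal c * ∫⁻ x, (ENNReal.ofReal √(1 - x ^ 2))⁻¹ ∂ψ := by
  simp [lineMeasure]

lemma withDensity_inv_withDensity_sqrt {ψ : Measure ℝ}
    (hint : ∫⁻ x, (ENNReal.ofReal √(1 - x ^ 2))⁻¹ ∂ψ < ⊤) :
    (ψ.withDensity fun x => (ENNReal.ofReal √(1 - x ^ 2))⁻¹).withDensity
      (fun x => ENNReal.ofReal √(1 - x ^ 2)) = ψ := by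
  have h := withDensity_inv_same (μ := ψ) (f := fun x => (ENNReal.ofReal √(1 - x ^ 2))⁻¹)
    (by fun_prop) (Filter.Eventually.of_forall fun x => by simp)
    ((ae_lt_top (by fun_prop) hint.ne).mono fun x hx => hx.ne)
  convert h using 2
  ext x
  simp

lemma isLineMeasure_lineMeasure {ψ : Measure ℝ} (hsupp : ψ (Set.Icc (-1) 1)ᶜ = 0)
    (hint : ∫⁻ x, (ENNReal.ofReal √(1 - x ^ 2))⁻¹ ∂ψ < ⊤) {t c : ℝ} (hc : 0 < c)
    (hmass : ENNReal.ofReal t +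
      ENNReal.ofReal c * ∫⁻ x, (ENNReal.ofReal √(1 - x ^ 2))⁻¹ ∂ψ = 1) :
    IsLineMeasure ψ (lineMeasure ψ t c) c where
  isProbabilityMeasure := ⟨(lineMeasure_univ ψ t c).trans hmass⟩
  support := by
    have h1 : (ψ.withDensity fun x => (ENNReal.ofReal √(1 - x ^ 2))⁻¹) (Set.Icc (-1) 1)ᶜ = 0 :=
      withDensity_absolutelyContinuous _ _ hsupp
    simp [lineMeasure, h1]
  pos := hc
  withDensity_eq := by
    rw [lineMeasure, withDensity_add_measure, withDensity_smul_measure, withDensity_smul_measure,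
      withDensity_inv_withDensity_sqrt hint]
    have : (Measure.dirac (1 : ℝ)).withDensity (fun x => ENNReal.ofReal √(1 - x ^ 2)) = 0 := by
      rw [withDensity_eq_zero_iff (by fun_prop)]
      rw [Filter.EventuallyEq, ae_dirac_iff (measurableSet_eq_fun (by fun_prop) (by fun_prop))]
      simp
    rw [this, smul_zero, zero_add]

lemma ae_mem_Ioo_lineMeasure {ψ : Measure ℝ}
    (hint : ∫⁻ x, (ENNReal.ofReal √(1 - x ^ 2))⁻¹ ∂ψ < ⊤) (c : ℝ) :
    ∀ᵐ x ∂lineMeasure ψ 0 c, x ∈ Set.Ioo (-1 : ℝ) 1 := by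
  rw [lineMeasure, ENNReal.ofReal_zero, zero_smul, zero_add]
  exact Measure.ae_smul_measure
    ((withDensity_absolutelyContinuous _ _).ae_le (ae_mem_Ioo hint)) _

lemma exp_two_arccos {x : ℝ} (hx : x ∈ Set.Icc (-1 : ℝ) 1) :
    Complex.exp (((2 * Real.arccos x : ℝ) : ℂ) * Complex.I) = halfPoint x ^ 2 := by
  rw [Complex.ofReal_mul, mul_assoc, Complex.ofReal_ofNat,
    ← Nat.cast_ofNat, Complex.exp_nat_mul, Complex.exp_mul_I, ← Complex.ofReal_cos,
    ← Complex.ofReal_sin, Real.cos_arccos hx.1 hx.2, Real.sin_arccos, halfPoint]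

/-- The half-angle formula, `θ` being taken in `[0, 2π)`. -/
lemma sin_circleAngle_div_two {z : ℂ} (hz : ‖z‖ = 1) :
    Real.sin (circleAngle z / 2) = √((1 - z.re) / 2) := by
  have hcos : Real.cos (circleAngle z) = z.re := by
    have h1 := Complex.norm_mul_cos_arg z
    rw [hz, one_mul] at h1
    unfold circleAngle
    split_ifs
    · exact h1
    · rw [Real.cos_add_two_pi, h1]
  have h0 : 0 ≤ circleAngle z ∧ circleAngle z ≤ 2 * Real.pi := by
    have h1 := Complex.neg_pi_lt_arg z
    have h2 := Complex.arg_le_pi z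
    unfold circleAngle
    split_ifs
    · constructor <;> linarith
    · constructor <;> linarith
  rw [Real.sin_half_eq_sqrt h0.1 h0.2, hcos]

lemma measurable_circleAngle : Measurable circleAngle :=
  Measurable.ite (measurableSet_le measurable_const Complex.measurable_arg)
    Complex.measurable_arg (Complex.measurable_arg.add_const _)

lemma sin_circleAngle_halfPoint_sq {x : ℝ} (hx : x ∈ Set.Icc (-1 : ℝ) 1) :
    Real.sin (circleAngle (halfPoint x ^ 2) / 2) = √(1 - x ^ 2) := by
  rw [sin_circleAngle_div_two (by rw [norm_pow, norm_halfPoint hx, one_pow])]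
  congr 1
  rw [sq (halfPoint x), Complex.mul_re, halfPoint_re, halfPoint_im, ← sq √_, sq_sqrt_one_sub hx]
  ring

lemma re_lt_one_of_ne_one {z : ℂ} (hz : ‖z‖ = 1) (h1 : z ≠ 1) : z.re < 1 := by
  refine lt_of_le_of_ne (hz ▸ Complex.re_le_norm z) fun h => h1 ?_
  have h2 : z.re * z.re + z.im * z.im = 1 := by
    rw [← Complex.normSq_apply, Complex.normSq_eq_norm_sq, hz, one_pow]
  have h3 : z.im = 0 := by
    rw [h] at h2
    exact mul_self_eq_zero.1 (by linarith)
  exact Complex.ext h h3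

lemma halfPoint_sq_ne_one {x : ℝ} (hx : x ∈ Set.Ioo (-1 : ℝ) 1) : halfPoint x ^ 2 ≠ 1 := by
  intro h
  have h1 := sin_circleAngle_halfPoint_sq ⟨hx.1.le, hx.2.le⟩
  rw [h, sin_circleAngle_div_two norm_one] at h1
  have h2 : 0 < √(1 - x ^ 2) := Real.sqrt_pos.2 (by nlinarith [hx.1, hx.2])
  rw [← h1] at h2
  simp at h2

lemma map_withDensity_comp {α β : Type*} [MeasurableSpace α] [MeasurableSpace β] (κ : Measure α)
    {f : α → β} (hf : Measurable f) {g : β → ENNReal} (hg : Measurable g) :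
    (κ.map f).withDensity g = (κ.withDensity fun x => g (f x)).map f := by
  ext s hs
  rw [withDensity_apply _ hs, setLIntegral_map hs hg hf, Measure.map_apply hf hs,
    withDensity_apply _ (hf hs)]

/-- A circle measure for `ψ` is the image of `t δ_1 + c (1-x²)^{-1/2} dψ` under `x ↦ e^{iθ}`,
`x = cos (θ/2)`: off the point `z = 1` the factor `sin (θ/2)` can be divided out. -/
theorem exists_lineMeasure_map_eq {ψ : Measure ℝ} (hsupp : ψ (Set.Icc (-1) 1)ᶜ = 0)
    (hint : ∫⁻ x, (ENNReal.ofReal √(1 - x ^ 2))⁻¹ ∂ψ < ⊤) {t : ℝ} (ht1 : t < 1) {μ : Measure ℂ}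
    (hμ : IsCircleMeasure ψ t μ) :
    ∃ c : ℝ, 0 < c ∧ μ = (lineMeasure ψ t c).map (fun x => halfPoint x ^ 2) ∧
      ENNReal.ofReal t + ENNReal.ofReal c * ∫⁻ x, (ENNReal.ofReal √(1 - x ^ 2))⁻¹ ∂ψ = 1 := by
  have := hμ.isProbabilityMeasure
  obtain ⟨c, hc⟩ := hμ.relation
  have hz : Measurable fun x : ℝ => halfPoint x ^ 2 := (continuous_halfPoint.pow 2).measurable
  set g : ℂ → ENNReal := fun z => ENNReal.ofReal (Real.sin (circleAngle z / 2)) with hg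
  have hgm : Measurable g := by
    have := measurable_circleAngle
    fun_prop
  have hIoo := ae_mem_Ioo hint
  rw [Measure.map_congr (g := fun x => halfPoint x ^ 2)
    ((ae_mem_Icc hsupp).mono fun x hx => exp_two_arccos hx)] at hc
  have hcirc : ∀ᵐ z ∂μ, ‖z‖ = 1 := by
    filter_upwards [measure_eq_zero_iff_ae_notMem.1 hμ.on_circle] with z hz
    simpa using hz
  have hS : MeasurableSet ({1}ᶜ : Set ℂ) := (measurableSet_singleton 1).compl
  have hgpos : ∀ᵐ z ∂μ.restrict {1}ᶜ, g z ≠ 0 := by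
    rw [ae_restrict_iff' hS]
    filter_upwards [hcirc] with z hz hz1
    have := re_lt_one_of_ne_one hz hz1
    rw [hg]
    refine (ENNReal.ofReal_pos.2 ?_).ne'
    rw [sin_circleAngle_div_two hz]
    exact Real.sqrt_pos.2 (by linarith)
  have hoff : μ.restrict {1}ᶜ =
      ((c : ENNReal) • ψ.withDensity fun x => (ENNReal.ofReal √(1 - x ^ 2))⁻¹).map
        fun x => halfPoint x ^ 2 := by
    have h1 := withDensity_inv_same (μ := μ.restrict {1}ᶜ) hgm hgpos
      (Filter.Eventually.of_forall fun z => ENNReal.ofReal_ne_top)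
    have h2 : (ψ.map fun x => halfPoint x ^ 2).restrict {1}ᶜ = ψ.map fun x => halfPoint x ^ 2 :=
      Measure.restrict_eq_self_of_ae_mem <| (ae_map_iff hz.aemeasurable hS).2 <|
        hIoo.mono fun x hx => halfPoint_sq_ne_one hx
    have h3 : (fun x => g⁻¹ (halfPoint x ^ 2)) =ᵐ[ψ] fun x => (ENNReal.ofReal √(1 - x ^ 2))⁻¹ := by
      filter_upwards [ae_mem_Icc hsupp] with x hx
      rw [Pi.inv_apply, hg, ← sin_circleAngle_halfPoint_sq hx]
    rw [← restrict_withDensity hS, hc, Measure.restrict_smul, h2] at h1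
    rw [← h1, ENNReal.smul_def, withDensity_smul_measure, Measure.map_smul,
      ← withDensity_congr_ae h3, ← map_withDensity_comp ψ hz hgm.inv]
    rfl
  have hμeq : μ = (lineMeasure ψ t c).map (fun x => halfPoint x ^ 2) := by
    rw [lineMeasure, Measure.map_add _ _ hz, Measure.map_smul, Measure.map_dirac' hz,
      halfPoint_one, one_pow, ENNReal.ofReal_coe_nnreal, ← hoff, ← hμ.jump,
      ← Measure.restrict_singleton, Measure.restrict_add_restrict_compl (measurableSet_singleton 1)]
  have hmass : ENNReal.ofReal t +
      ENNReal.ofReal c * ∫⁻ x, (ENNReal.ofReal √(1 - x ^ 2))⁻¹ ∂ψ = 1 := by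
    have h1 := measure_univ (μ := μ)
    rw [hμeq, Measure.map_apply hz MeasurableSet.univ] at h1
    rwa [Set.preimage_univ, lineMeasure_univ] at h1
  refine ⟨c, ?_, hμeq, hmass⟩
  refine lt_of_le_of_ne c.2 fun h0 => ?_
  rw [← h0, ENNReal.ofReal_zero, zero_mul, add_zero, ENNReal.ofReal_eq_one] at hmass
  exact ht1.ne hmass

/-! ### The orthogonal polynomials on the circle -/

section

variable {ψ ν : Measure ℝ} {c : ℝ}

lemma eq_zero_of_orthogonal (h : IsLineMeasure ψ ν c)
    (hsupp : ψ (Set.Icc (-1) 1)ᶜ = 0) (hinf : ∀ s : Set ℝ, s.Finite → ψ sᶜ ≠ 0) {m : ℕ} {q : ℂ[X]}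
    (hdeg : q.natDegree ≤ m) (horth : ∀ k ≤ m,
      ∫ x, starRingEnd ℂ ((halfPoint x ^ 2) ^ k) * q.eval (halfPoint x ^ 2) ∂ν = 0) : q = 0 := by
  have := h.isProbabilityMeasure
  have hw := continuous_halfPoint
  have hq : Continuous fun x => q.eval (halfPoint x ^ 2) := q.continuous.comp (hw.pow 2)
  by_contra hne
  have hpos : 0 < ∫ x, ‖q.eval (halfPoint x ^ 2)‖ ^ 2 ∂ν := by
    refine integral_pos_of_finite_zeros hsupp hinf h.support h.absolutelyContinuous (by fun_prop)
      (fun x => by positivity) ((finite_zeros_eval_sq hne).subset fun x hx => ?_)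
    simpa using hx.2
  have hexp : ∀ x, ((‖q.eval (halfPoint x ^ 2)‖ ^ 2 : ℝ) : ℂ) =
      ∑ k ∈ Finset.range (m + 1), starRingEnd ℂ (q.coeff k) *
        (starRingEnd ℂ ((halfPoint x ^ 2) ^ k) * q.eval (halfPoint x ^ 2)) := fun x => by
    rw [Complex.ofReal_pow, ← Complex.conj_mul']
    nth_rw 1 [eval_eq_sum_range' (Nat.lt_succ_of_le hdeg)]
    rw [map_sum, Finset.sum_mul]
    simp only [map_mul, mul_assoc]
  have hzero : ((∫ x, ‖q.eval (halfPoint x ^ 2)‖ ^ 2 ∂ν : ℝ) : ℂ) = 0 := by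
    rw [← integral_complex_ofReal]
    simp only [hexp]
    rw [integral_finsetSum _ fun k _ => integrable_of_continuous h.support (by fun_prop)]
    refine Finset.sum_eq_zero fun k hk => ?_
    rw [integral_const_mul, horth k (Nat.lt_succ_iff.1 (Finset.mem_range.1 hk)), mul_zero]
  rw [Complex.ofReal_eq_zero] at hzero
  exact hpos.ne' hzero

/-- Conjugate powers of `z = e^{iθ}` against `R_m` are moments of `Ŵ_m` with common value `e_m`. -/
lemma integral_conj_pow_mul_kernelPoly [IsFiniteMeasure ψ] (h : IsLineMeasure ψ ν c)
    (hsupp : ψ (Set.Icc (-1) 1)ᶜ = 0) (hinf : ∀ s : Set ℝ, s.Finite → ψ sᶜ ≠ 0) {m k : ℕ}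
    (hk : k ≤ m) :
    ∫ x, starRingEnd ℂ ((halfPoint x ^ 2) ^ k) * (kernelPoly ψ m).eval (halfPoint x ^ 2) ∂ν =
      kernelMean ψ ν m := by
  rw [← moment_WHat_eq_kernelMean h hsupp hinf m (m - k) (by omega), moment]
  refine integral_congr_ae ?_
  filter_upwards [ae_mem_Icc h.support] with x hx
  have hx0 := halfPoint_ne_zero x
  rw [← halfPoint_pow_mul_WHat ψ m hx, map_pow, map_pow, conj_halfPoint hx, ← mul_assoc,
    show (2 * ((m - k : ℕ) : ℤ) - m : ℤ) = m - 2 * k by push_cast [Nat.cast_sub hk]; ring,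
    zpow_sub₀ hx0, zpow_mul, zpow_natCast, zpow_natCast, zpow_ofNat, inv_pow, inv_pow,
    div_eq_inv_mul]

/-- The monic orthogonal polynomial is `S_{m+1} = (R_{m+1} - (e_{m+1} / e_m) R_m) / L_{m+1}`. -/
theorem kernelLead_mul_eq [IsFiniteMeasure ψ] (h : IsLineMeasure ψ ν c)
    (hsupp : ψ (Set.Icc (-1) 1)ᶜ = 0) (hinf : ∀ s : Set ℝ, s.Finite → ψ sᶜ ≠ 0) {S : ℕ → ℂ[X]}
    (hS : IsMonicOPUC (ν.map fun x => halfPoint x ^ 2) S) (m : ℕ) :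
    C (kernelLead ψ (m + 1)) * S (m + 1) =
      kernelPoly ψ (m + 1) -
        C (((kernelMean ψ ν (m + 1) / kernelMean ψ ν m : ℝ) : ℂ)) * kernelPoly ψ m := by
  have := h.isProbabilityMeasure
  have hw := continuous_halfPoint
  obtain ⟨hmonic, hdeg, horth⟩ := hS (m + 1)
  set γ : ℂ := ((kernelMean ψ ν (m + 1) / kernelMean ψ ν m : ℝ) : ℂ) with hγ
  have hγe : γ * kernelMean ψ ν m = kernelMean ψ ν (m + 1) := by
    rw [hγ, ← Complex.ofReal_mul, div_mul_cancel₀ _ (kernelMean_ne_zero h hsupp hinf m)]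
  set q := kernelPoly ψ (m + 1) - C γ * kernelPoly ψ m - C (kernelLead ψ (m + 1)) * S (m + 1)
    with hq
  have hle : q.natDegree ≤ m + 1 := by
    refine (natDegree_sub_le_of_le (natDegree_sub_le_of_le (natDegree_kernelPoly_le ψ (m + 1))
      ((natDegree_C_mul_le _ _).trans ((natDegree_kernelPoly_le ψ m).trans (Nat.le_succ m))))
      ((natDegree_C_mul_le _ _).trans hdeg.le)).trans ?_
    simp
  have hcoeff : q.coeff (m + 1) = 0 := by
    have h1 : (S (m + 1)).coeff (m + 1) = 1 := by
      have := hmonic.coeff_natDegree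
      rwa [hdeg] at this
    have h2 : (kernelPoly ψ m).coeff (m + 1) = 0 :=
      coeff_eq_zero_of_natDegree_lt (Nat.lt_succ_of_le (natDegree_kernelPoly_le ψ m))
    simp [hq, coeff_kernelPoly, h1, h2]
  have hqdeg : q.natDegree ≤ m := by
    rw [natDegree_le_iff_coeff_eq_zero]
    intro N hN
    rcases Nat.eq_or_lt_of_le (Nat.succ_le_of_lt hN) with rfl | hlt
    · exact hcoeff
    · exact coeff_eq_zero_of_natDegree_lt (hle.trans_lt hlt)
  have hq0 : q = 0 := by
    refine eq_zero_of_orthogonal h hsupp hinf hqdeg fun k hk => ?_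
    have hSk := horth k (by omega)
    rw [integral_map (φ := fun x => halfPoint x ^ 2)
      (hw.pow 2).aemeasurable
      (Continuous.aestronglyMeasurable (by fun_prop))] at hSk
    have hint : ∀ p : ℂ[X], Integrable (fun x =>
        starRingEnd ℂ ((halfPoint x ^ 2) ^ k) * p.eval (halfPoint x ^ 2)) ν := fun p =>
      integrable_of_continuous h.support (by fun_prop)
    have hexp : ∀ x, starRingEnd ℂ ((halfPoint x ^ 2) ^ k) * q.eval (halfPoint x ^ 2) =
        starRingEnd ℂ ((halfPoint x ^ 2) ^ k) * (kernelPoly ψ (m + 1)).eval (halfPoint x ^ 2) -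
        γ * (starRingEnd ℂ ((halfPoint x ^ 2) ^ k) * (kernelPoly ψ m).eval (halfPoint x ^ 2)) -
        kernelLead ψ (m + 1) *
          (starRingEnd ℂ ((halfPoint x ^ 2) ^ k) * (S (m + 1)).eval (halfPoint x ^ 2)) := by
      intro x
      simp only [hq, eval_sub, eval_mul, eval_C]
      ring
    simp only [hexp]
    rw [integral_sub (integrable_of_continuous h.support (by fun_prop)) ((hint _).const_mul _),
      integral_sub (hint _) ((hint _).const_mul _), integral_const_mul, integral_const_mul, hSk,
      integral_conj_pow_mul_kernelPoly h hsupp hinf (by omega),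
      integral_conj_pow_mul_kernelPoly h hsupp hinf hk, hγe]
    simp
  exact (sub_eq_zero.1 hq0).symm

lemma kernelLead_div_conj (ψ : Measure ℝ) (m : ℕ) :
    kernelLead ψ m / starRingEnd ℂ (kernelLead ψ m) = 1 / tauSeq ψ m := by
  induction m with
  | zero => simp [kernelLead, tauSeq]
  | succ m ih =>
    have h0 : starRingEnd ℂ (kernelLead ψ m) ≠ 0 := by simpa using kernelLead_ne_zero ψ m
    have hm := one_sub_I_mul_ne_zero (betaHat ψ (m + 1))
    have hp := one_add_I_mul_ne_zero (betaHat ψ (m + 1))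
    have hconj : starRingEnd ℂ (kernelLead ψ (m + 1)) =
        (1 - Complex.I * betaHat ψ (m + 1)) / 2 * starRingEnd ℂ (kernelLead ψ m) := by
      simp [kernelLead, map_ofNat, sub_eq_add_neg]
    have hτ : 1 / tauSeq ψ (m + 1) = (1 + Complex.I * betaHat ψ (m + 1)) /
        (1 - Complex.I * betaHat ψ (m + 1)) * (1 / tauSeq ψ m) := by
      rw [tauSeq, one_div, mul_inv, inv_div, one_div]
    rw [hτ, ← ih, hconj, kernelLead]
    field_simp

lemma verblunsky_eq [IsFiniteMeasure ψ] (h : IsLineMeasure ψ ν c)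
    (hsupp : ψ (Set.Icc (-1) 1)ᶜ = 0) (hinf : ∀ s : Set ℝ, s.Finite → ψ sᶜ ≠ 0) {S : ℕ → ℂ[X]}
    (hS : IsMonicOPUC (ν.map fun x => halfPoint x ^ 2) S) (m : ℕ) :
    verblunsky S m = 1 / tauSeq ψ m *
      ((1 - 2 * (chainParam ψ ν (m + 1) : ℂ) - Complex.I * (betaHat ψ (m + 1) : ℂ)) /
        (1 - Complex.I * (betaHat ψ (m + 1) : ℂ))) := by
  have h1 := congrArg (fun p => starRingEnd ℂ (eval 0 p)) (kernelLead_mul_eq h hsupp hinf hS m)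
  have h0 : starRingEnd ℂ (kernelLead ψ m) ≠ 0 := by simpa using kernelLead_ne_zero ψ m
  have hm := one_sub_I_mul_ne_zero (betaHat ψ (m + 1))
  simp only [eval_mul, eval_sub, eval_C, kernelPoly_eval_zero, map_sub, map_mul,
    Complex.conj_conj, Complex.conj_ofReal, kernelLead, map_add, map_div₀, map_one, map_ofNat,
    Complex.conj_I, map_neg, neg_neg] at h1
  rw [verblunsky, ← kernelLead_div_conj, chainParam]
  set γ : ℝ := kernelMean ψ ν (m + 1) / kernelMean ψ ν m
  push_cast
  field_simp
  linear_combination -2 * h1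

end

end VerblunskyChain

end

open VerblunskyChain in
theorem mainTheorem5 (ψ : Measure ℝ)
    (hsupp : ψ (Set.Icc (-1) 1)ᶜ = 0)
    (hinf : ∀ s : Set ℝ, s.Finite → ψ sᶜ ≠ 0)
    (hint : ∫⁻ x, (ENNReal.ofReal √(1 - x ^ 2))⁻¹ ∂ψ < ⊤)
    (t : ℝ) (ht0 : 0 ≤ t) (ht1 : t < 1)
    (μ : Measure ℂ) (hμ : IsCircleMeasure ψ t μ)
    (S : ℕ → Polynomial ℂ) (hS : IsMonicOPUC μ S) :
    ∃ M 𝔪 : ℕ → ℝ,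
      IsMaximalParameterSequence (fun n => alphaHat ψ (n + 1)) (fun n => M (n + 1)) ∧
      IsMinimalParameterSequence (alphaTilde ψ t M) 𝔪 ∧
      ∀ m : ℕ, 1 ≤ m →
        verblunsky S (m - 1) =
          1 / tauSeq ψ (m - 1) *
            ((1 - 2 * (𝔪 m : ℂ) - Complex.I * (betaHat ψ m : ℂ)) /
              (1 - Complex.I * (betaHat ψ m : ℂ))) := by
  have := isFiniteMeasure_of_lintegral_inv_lt_top hint
  obtain ⟨c, hc, rfl, hmass⟩ := exists_lineMeasure_map_eq hsupp hint ht1 hμ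
  have ht : 0 < 1 - t := sub_pos.2 ht1
  -- Removing the mass at `z = 1` and renormalizing replaces `c` by `c / (1 - t)`.
  have hmass0 : ENNReal.ofReal 0 +
      ENNReal.ofReal (c / (1 - t)) * ∫⁻ x, (ENNReal.ofReal √(1 - x ^ 2))⁻¹ ∂ψ = 1 := by
    lift ∫⁻ x, (ENNReal.ofReal √(1 - x ^ 2))⁻¹ ∂ψ to NNReal using hint.ne with I
    have h1 := congrArg ENNReal.toReal hmass
    rw [ENNReal.toReal_add (by simp) (ENNReal.mul_ne_top (by simp) (by simp)), ENNReal.toReal_mul,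
      ENNReal.toReal_ofReal ht0, ENNReal.toReal_ofReal hc.le, ENNReal.coe_toReal,
      ENNReal.toReal_one] at h1
    rw [ENNReal.ofReal_zero, zero_add, ← ENNReal.ofReal_coe_nnreal,
      ← ENNReal.ofReal_mul (by positivity), ENNReal.ofReal_eq_one]
    field_simp
    linarith
  have hν := isLineMeasure_lineMeasure hsupp hint hc hmass
  have hν0 := isLineMeasure_lineMeasure hsupp hint (div_pos hc ht) hmass0
  have hpar := isParameterSequence_chainParam hν hsupp hinf
  refine ⟨chainParam ψ (lineMeasure ψ 0 (c / (1 - t))), chainParam ψ (lineMeasure ψ t c),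
    isMaximalParameterSequence_chainParam hν0 hsupp hinf (ae_mem_Ioo_lineMeasure hint _),
    ⟨⟨le_rfl, one_pos, ?_, ?_, ?_⟩, rfl⟩, ?_⟩
  · intro n hn
    obtain ⟨n, rfl⟩ : ∃ k, n = k + 1 := ⟨n - 1, by omega⟩
    exact chainParam_pos hν hsupp hinf n
  · intro n hn
    obtain ⟨n, rfl⟩ : ∃ k, n = k + 1 := ⟨n - 1, by omega⟩
    exact chainParam_lt_one hν hsupp hinf n
  · intro n
    cases n with
    | zero =>
      rw [zero_add, alphaTilde, chainParam_one hν hsupp hinf, chainParam_one hν0 hsupp hinf,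
        chainParam]
      field_simp
      ring
    | succ n => exact alphaHat_eq_chainParam hν hsupp hinf n
  · intro m hm
    obtain ⟨m, rfl⟩ : ∃ k, m = k + 1 := ⟨m - 1, by omega⟩
    exact verblunsky_eq hν hsupp hinf hS m
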